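/- **Setting.** Let $d\in\{2,3\}$, let $\Omega\subset\mathbb R^d$ be a bounded polyhedral Lipschitz domain with boundary $\Gamma$ and outward unit normal $n$, and let $T>0$. Let $\bar\Omega=\bigcup_{j=1}^J\bar\Omega_j$ with pairwise disjoint polyhedral subdomains $\Omega_j$, and let $\rho,\omega$ be piecewise constant, $\rho|_{\Omega_j}=\rho_j>0$, $\omega|_{\Omega_j}=\omega_j\ge 0$. Let $\Omega_E$ be the union of the $\Omega_j$ with $\omega_j=0$, and let $\tilde\omega^{-1}$ be $1/\omega$ where $\omega\neq0$ and $0$ on $\Omega_E$. Let $\mathcal C,\mathcal D$ be constant fourth order tensors, i.e. linear maps on $\mathbb R^{d\times d}$, which are symmetric and positive definite with respect to $\sigma:\tau=\operatorname{tr}(\sigma^{t}\tau)$, map symmetric matrices to symmetric matrices, and are such that $\mathcal D-\mathcal C$ is positive definite. Put $\mathcal A=\mathcal C^{-1}$, $\mathcal V=(\mathcal D-\mathcal C)^{-1}$. Gradient and divergence are taken row-wise, $(\nabla u)_{ij}=\partial_j u_i$, $\varepsilon(u)=\frac12(\nabla u+(\nabla u)^t)$; $(\cdot,\cdot)$ is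 the $L^2(\Omega)$ inner product, $(v,w)_\rho=(\rho^{-1}v,w)$, and $\langle\cdot,\cdot\rangle_\Gamma$ is the duality between $H^{1/2}(\Gamma)^d$ and $H^{-1/2}(\Gamma)^d$. For a space $V$, $L^2(V)$, $H^k(V)$, $\mathcal C^0(V)$ denote spaces of $V$-valued functions on $(0,T)$, resp. $[0,T]$. Let $\mathfrak L^2(\Omega)=L^2(\Omega)^{d\times d}\times L^2(\Omega)^{d\times d}$ and, for $q=(\eta,\tau)$, let $\jmath_\omega q=(\eta,\omega\tau)$, $\jmath_\omega^+q=\eta+\omega\tau$, $\pi_2q=(0,\tau)$ and $A\big((\gamma,\zeta),(\eta,\tau)\big)=(\mathcal A\gamma,\eta)+(\mathcal V\zeta,\tau)$. Let $\mathfrak S$ be the space of all $q=(\eta,\tau)\in\mathfrak L^2(\Omega)$ with $\tau=0$ on $\Omega_E$ and $\operatorname{div}\jmath_\omega^+q\in L^2(\Omega)^d$, normed by $\|q\|_{\mathfrak S}^2=\|\eta\|^2+\|\omega\tau\|^2+\|\operatorname{div}\jmath^+_\omega q\|^2$, let $\mathfrak S_{\rm sym}$ be its subspace where $\jmath_\omega^+q$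 is symmetric, and let $\mathbb Q$ be the space of skew-symmetric tensor fields in $L^2(\Omega)^{d\times d}$. Let $F\in L^2(L^2(\Omega)^d)$, $g\in H^2(H^{1/2}(\Gamma)^d)$, $u_0,u_1\in H^1(\Omega)^d$, $\sigma_0\in L^2(\Omega)^{d\times d}$, and put $\gamma_0=\mathcal C\varepsilon(u_0)$, $\zeta_0=\tilde\omega^{-1}(\sigma_0-\gamma_0)$, $\gamma_1=\mathcal C\varepsilon(u_1)$, $\zeta_1=\tilde\omega^{-1}(\mathcal D\varepsilon(u_1)-\gamma_1-\zeta_0)$, where $p_0=(\gamma_0,\zeta_0)$ is assumed to lie in $\mathfrak S_{\rm sym}$, and $p_1=(\gamma_1,\zeta_1)$. Let $p\in H^1(\mathfrak S_{\rm sym})$ with $\ddot p\in L^2(\mathfrak S_{\rm sym}')$, and let $r\in\mathcal C^0(\mathbb Q)$, be such that, in the sense of distributions on $(0,T)$, $$\frac{d}{dt}\Big\{A(\jmath_\omega\dot p+\pi_2p,\jmath_\omega q)+(r,\jmath_\omega^+q)\Big\}+(\operatorname{div}\jmath_\omega^+p,\operatorname{div}\jmath_\omega^+q)_\rho=-(F,\operatorname{div}\jmath_\omega^+q)_\rho+\langle\ddot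 g,\jmath_\omega^+q\,n\rangle_\Gamma\qquad\forall q\in\mathfrak S,$$ $(s,\jmath_\omega^+p(t))=0$ for all $s\in\mathbb Q$ and $t\in[0,T]$, and $p(0)=p_0$, $\dot p(0)=p_1$, $r(0)=0$. Let $u\in H^2(L^2(\Omega)^d)$ be the displacement field given by $\rho\ddot u=F+\operatorname{div}\jmath_\omega^+p$, $u(0)=u_0$, $\dot u(0)=u_1$. **Proposition.** If $\ddot p\in L^2(\mathfrak L^2(\Omega))$ and $\dot r\in L^2(\mathbb Q)$, then $\ddot u\in L^2(H^1(\Omega)^d)$, and for every $t\in[0,T]$ one has $\dot u(t)\in H^1(\Omega)^d$ and $$r(t)=\tfrac12\big\{\nabla\dot u(t)-(\nabla\dot u(t))^{t}\big\}-\tfrac12\big\{\nabla u_1-(\nabla u_1)^{t}\big\}.$$ -/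

import Mathlib

open MeasureTheory Set
open scoped ENNReal RealInnerProductSpace

noncomputable section

namespace Zener

/-! ### Vectors, matrices and fourth order tensors -/

/-- `ℝ^d` with its Euclidean norm. -/
abbrev Vec (d : ℕ) := EuclideanSpace ℝ (Fin d)

/-- `ℝ^{d×d}` with the component-wise inner product `σ : τ = tr(σᵀ τ)`; the entry `(i, j)` of `τ` is
`τ (i, j)`. -/
abbrev Mat (d : ℕ) := EuclideanSpace ℝ (Fin d × Fin d)

/-- The transpose, `τᵀ (i, j) = τ (j, i)`. -/
def transp (d : ℕ) : Mat d →L[ℝ] Mat d :=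
  (LinearIsometryEquiv.piLpCongrLeft 2 ℝ ℝ
    (Equiv.prodComm (Fin d) (Fin d))).toContinuousLinearEquiv.toContinuousLinearMap

theorem transp_apply {d : ℕ} (τ : Mat d) (i j : Fin d) : transp d τ (i, j) = τ (j, i) := rfl

/-- The symmetric part `(τ + τᵀ) / 2`. -/
def symPart (d : ℕ) : Mat d →L[ℝ] Mat d :=
  (1 / 2 : ℝ) • (ContinuousLinearMap.id ℝ (Mat d) + transp d)

/-- The skew-symmetric part `(τ - τᵀ) / 2`. -/
def skewPart (d : ℕ) : Mat d →L[ℝ] Mat d :=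
  (1 / 2 : ℝ) • (ContinuousLinearMap.id ℝ (Mat d) - transp d)

/-- A fourth order tensor, acting linearly on matrices, is symmetric (`σ : Cτ = Cσ : τ`). -/
def IsSymmTensor {d : ℕ} (C : Mat d →L[ℝ] Mat d) : Prop :=
  ∀ σ τ : Mat d, ⟪C σ, τ⟫ = ⟪σ, C τ⟫

/-- Positive definiteness of a fourth order tensor. -/
def IsPosDefTensor {d : ℕ} (C : Mat d →L[ℝ] Mat d) : Prop :=
  ∀ σ : Mat d, σ ≠ 0 → 0 < ⟪C σ, σ⟫

/-- `C` maps symmetric matrices (strains) to symmetric matrices (stresses). -/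
def PreservesSymm {d : ℕ} (C : Mat d →L[ℝ] Mat d) : Prop :=
  ∀ σ : Mat d, transp d σ = σ → transp d (C σ) = C σ

/-! ### Polyhedral Lipschitz domains -/

/-- A polygonal / polyhedral domain: nonempty, connected, equal to the interior of its closure,
and its closure is a finite union of convex polytopes. -/
structure IsPolyhedralDomain {d : ℕ} (U : Set (Vec d)) : Prop where
  connected : IsConnected U
  regular : interior (closure U) = U
  polyhedral : ∃ P : Finset (Finset (Vec d)),
    closure U = ⋃ V ∈ P, convexHull ℝ (V : Set (Vec d))

/-- Near every boundary point, `U` is the strict epigraph of a Lipschitz function in some direction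
`n`; the vector `y - ⟪n, y⟫ n` is the projection of `y` onto the hyperplane orthogonal to `n`. -/
def HasLipschitzBoundary {d : ℕ} (U : Set (Vec d)) : Prop :=
  ∀ x ∈ frontier U, ∃ (n : Vec d) (K : NNReal) (f : Vec d → ℝ) (N : Set (Vec d)),
    ‖n‖ = 1 ∧ LipschitzWith K f ∧ N ∈ nhds x ∧
      ∀ y ∈ N, y ∈ U ↔ f (y - ⟪n, y⟫ • n) < ⟪n, y⟫

/-! ### Lebesgue spaces and weak derivatives on `Ω` -/

/-- `L²(Ω)^d`. -/
abbrev L2Vec {d : ℕ} (Ω : Set (Vec d)) := Lp (Vec d) 2 (volume.restrict Ω)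

/-- `L²(Ω)^{d×d}`. -/
abbrev L2Mat {d : ℕ} (Ω : Set (Vec d)) := Lp (Mat d) 2 (volume.restrict Ω)

/-- Pairs of tensor fields, `L²(Ω)^{d×d} × L²(Ω)^{d×d}`. -/
abbrev PairL2 {d : ℕ} (Ω : Set (Vec d)) := WithLp 2 (L2Mat Ω × L2Mat Ω)

/-- A constant fourth order tensor acting pointwise on tensor fields. -/
def onL2 {d : ℕ} (Ω : Set (Vec d)) (C : Mat d →L[ℝ] Mat d) : L2Mat Ω →L[ℝ] L2Mat Ω :=
  C.compLpL 2 (volume.restrict Ω)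

/-- Smooth fields with compact support contained in `Ω`. -/
structure TestField {d : ℕ} (Ω : Set (Vec d)) (W : Type) [NormedAddCommGroup W]
    [NormedSpace ℝ W] where
  toFun : Vec d → W
  smooth : ContDiff ℝ (⊤ : ℕ∞) toFun
  compact : HasCompactSupport toFun
  supp : tsupport toFun ⊆ Ω

/-- The partial derivative `∂_j φ`. -/
def partialDeriv {d : ℕ} {W : Type} [NormedAddCommGroup W] [NormedSpace ℝ W]
    (φ : Vec d → W) (j : Fin d) (x : Vec d) : W :=
  fderiv ℝ φ x (EuclideanSpace.single j 1)

/-- The row-wise gradient `(∇φ)_{ij} = ∂_j φ_i`. -/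
def grad {d : ℕ} (φ : Vec d → Vec d) (x : Vec d) : Mat d :=
  WithLp.toLp 2 fun ij => partialDeriv φ ij.2 x ij.1

/-- The row-wise divergence `(div Ψ)_i = ∑_j ∂_j Ψ_{ij}`. -/
def diverg {d : ℕ} (Ψ : Vec d → Mat d) (x : Vec d) : Vec d :=
  WithLp.toLp 2 fun i => ∑ j, partialDeriv Ψ j x (i, j)

namespace TestField

variable {d : ℕ} {Ω : Set (Vec d)} {W : Type} [NormedAddCommGroup W] [NormedSpace ℝ W]

theorem memLp (φ : TestField Ω W) : MemLp φ.toFun 2 (volume.restrict Ω) :=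
  φ.smooth.continuous.memLp_of_hasCompactSupport φ.compact

theorem continuous_partialDeriv (φ : TestField Ω W) (j : Fin d) :
    Continuous (partialDeriv φ.toFun j) :=
  (φ.smooth.continuous_fderiv (by simp)).clm_apply continuous_const

theorem partialDeriv_eq_zero (φ : TestField Ω W) (j : Fin d) (x : Vec d)
    (hx : x ∉ tsupport φ.toFun) : partialDeriv φ.toFun j x = 0 := by
  have : fderiv ℝ φ.toFun x = 0 := by
    by_contra h
    exact hx (support_fderiv_subset ℝ h)
  simp [partialDeriv, this]

theorem memLp_grad (φ : TestField Ω (Vec d)) : MemLp (grad φ.toFun) 2 (volume.restrict Ω) := by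
  refine Continuous.memLp_of_hasCompactSupport ?_ ?_
  · unfold grad
    have := φ.continuous_partialDeriv
    fun_prop
  · refine HasCompactSupport.intro φ.compact fun x hx => ?_
    ext ij
    simp [grad, φ.partialDeriv_eq_zero _ x hx]

theorem memLp_diverg (Ψ : TestField Ω (Mat d)) :
    MemLp (diverg Ψ.toFun) 2 (volume.restrict Ω) := by
  refine Continuous.memLp_of_hasCompactSupport ?_ ?_
  · unfold diverg
    have := Ψ.continuous_partialDeriv
    fun_prop
  · refine HasCompactSupport.intro Ψ.compact fun x hx => ?_
    ext i
    simp [diverg, Ψ.partialDeriv_eq_zero _ x hx]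

/-- A test field as an element of `L²(Ω)`. -/
def toL2 (φ : TestField Ω W) : Lp W 2 (volume.restrict Ω) := φ.memLp.toLp φ.toFun

/-- The gradient of a vector test field as an element of `L²(Ω)^{d×d}`. -/
def gradL2 (φ : TestField Ω (Vec d)) : L2Mat Ω := φ.memLp_grad.toLp _

/-- The divergence of a matrix test field as an element of `L²(Ω)^d`. -/
def divergL2 (Ψ : TestField Ω (Mat d)) : L2Vec Ω := Ψ.memLp_diverg.toLp _

end TestField

/-- `w` is the weak row-wise divergence of `τ` in `Ω`. -/
def HasWeakDiv {d : ℕ} {Ω : Set (Vec d)} (τ : L2Mat Ω) (w : L2Vec Ω) : Prop :=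
  ∀ φ : TestField Ω (Vec d), ⟪τ, φ.gradL2⟫ = -⟪w, φ.toL2⟫

/-- `G` is the weak gradient of `v` in `Ω`. -/
def HasWeakGrad {d : ℕ} {Ω : Set (Vec d)} (v : L2Vec Ω) (G : L2Mat Ω) : Prop :=
  ∀ Ψ : TestField Ω (Mat d), ⟪v, Ψ.divergL2⟫ = -⟪G, Ψ.toL2⟫

/-- `H¹(Ω)^d` as the space of pairs `(v, ∇v)`, so that
`‖v‖² = ‖v‖²_{L²} + ‖∇v‖²_{L²}`. -/
def H1 {d : ℕ} (Ω : Set (Vec d)) : Submodule ℝ (WithLp 2 (L2Vec Ω × L2Mat Ω)) where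
  carrier := {h | HasWeakGrad h.fst h.snd}
  zero_mem' := by intro Ψ; simp
  add_mem' := by
    intro a b ha hb Ψ
    have h1 := ha Ψ
    have h2 := hb Ψ
    simp only [WithLp.add_fst, WithLp.add_snd, inner_add_left] at *
    linarith
  smul_mem' := by
    intro c a ha Ψ
    have h1 := ha Ψ
    simp only [WithLp.smul_fst, WithLp.smul_snd, real_inner_smul_left] at *
    rw [h1]; ring

namespace H1

variable {d : ℕ} {Ω : Set (Vec d)}

/-- The function `v ∈ L²(Ω)^d` underlying an element of `H¹(Ω)^d`. -/
def value (h : H1 Ω) : L2Vec Ω := h.1.fst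

/-- The weak gradient `∇v`. -/
def gradient (h : H1 Ω) : L2Mat Ω := h.1.snd

/-- The strain `ε(v) = (∇v + (∇v)ᵀ) / 2`. -/
def strain (h : H1 Ω) : L2Mat Ω := onL2 Ω (symPart d) (gradient h)

theorem isClosed (Ω : Set (Vec d)) :
    IsClosed (H1 Ω : Set (WithLp 2 (L2Vec Ω × L2Mat Ω))) := by
  have : (H1 Ω : Set (WithLp 2 (L2Vec Ω × L2Mat Ω))) =
      ⋂ Ψ : TestField Ω (Mat d),
        {h : WithLp 2 (L2Vec Ω × L2Mat Ω) | ⟪h.fst, Ψ.divergL2⟫ = -⟪h.snd, Ψ.toL2⟫} := by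
    ext h
    simp [H1, HasWeakGrad]
  rw [this]
  exact isClosed_iInter fun Ψ => isClosed_eq (by fun_prop) (by fun_prop)

instance : CompleteSpace (H1 Ω) := (isClosed Ω).completeSpace_coe

end H1

/-- `H¹₀(Ω)^d`: the closure in `H¹(Ω)^d` of the smooth fields with compact support in `Ω`. -/
def H10 {d : ℕ} (Ω : Set (Vec d)) : Submodule ℝ (H1 Ω) :=
  (Submodule.span ℝ
    {h : H1 Ω | ∃ φ : TestField Ω (Vec d), H1.value h = φ.toL2 ∧ H1.gradient h = φ.gradL2}).topologicalClosure

instance {d : ℕ} (Ω : Set (Vec d)) : IsClosed (H10 Ω : Set (H1 Ω)) :=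
  Submodule.isClosed_topologicalClosure _

/-- `H^{1/2}(Γ)^d`, the space of traces on `Γ = ∂Ω` of the fields in `H¹(Ω)^d`. Two fields have the
same trace if and only if their difference lies in `H¹₀(Ω)^d`, and the norm of a trace is the
smallest norm of a field in `H¹(Ω)^d` with this trace. -/
abbrev TraceSpace {d : ℕ} (Ω : Set (Vec d)) := H1 Ω ⧸ H10 Ω

/-- The linear form `h ↦ (∇h, τ) + (h, w)` on `H¹(Ω)^d`. -/
def greenForm {d : ℕ} {Ω : Set (Vec d)} (τ : L2Mat Ω) (w : L2Vec Ω) : H1 Ω →L[ℝ] ℝ :=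
  (innerSL ℝ τ).comp ((WithLp.sndL 2 ℝ (L2Vec Ω) (L2Mat Ω)).comp (H1 Ω).subtypeL) +
    (innerSL ℝ w).comp ((WithLp.fstL 2 ℝ (L2Vec Ω) (L2Mat Ω)).comp (H1 Ω).subtypeL)

theorem greenForm_apply {d : ℕ} {Ω : Set (Vec d)} (τ : L2Mat Ω) (w : L2Vec Ω) (h : H1 Ω) :
    greenForm τ w h = ⟪τ, H1.gradient h⟫ + ⟪w, H1.value h⟫ := rfl

theorem H10_le_ker_greenForm {d : ℕ} {Ω : Set (Vec d)} {τ : L2Mat Ω} {w : L2Vec Ω}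
    (hw : HasWeakDiv τ w) : H10 Ω ≤ LinearMap.ker (greenForm τ w).toLinearMap := by
  refine Submodule.topologicalClosure_minimal _ ?_ (greenForm τ w).isClosed_ker
  rw [Submodule.span_le]
  rintro h ⟨φ, h1, h2⟩
  have := hw φ
  simp only [SetLike.mem_coe, LinearMap.mem_ker, ContinuousLinearMap.coe_coe, greenForm_apply,
    h1, h2]
  linarith

/-- The duality pairing `⟨b, τ n⟩_Γ` between `b ∈ H^{1/2}(Γ)^d` and the normal trace
`τ n ∈ H^{-1/2}(Γ)^d` of a field `τ` with weak divergence `w ∈ L²(Ω)^d`: by definition of the normal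
trace it is `(∇h, τ) + (h, div τ)` for every `h ∈ H¹(Ω)^d` with trace `b`. -/
def normalPairing {d : ℕ} {Ω : Set (Vec d)} (τ : L2Mat Ω) (w : L2Vec Ω) (hw : HasWeakDiv τ w) :
    TraceSpace Ω →ₗ[ℝ] ℝ :=
  (H10 Ω).liftQ (greenForm τ w).toLinearMap (H10_le_ker_greenForm hw)

/-- The space of skew-symmetric tensor fields in `L²(Ω)^{d×d}`. -/
def SkewL2 {d : ℕ} (Ω : Set (Vec d)) : Submodule ℝ (L2Mat Ω) :=
  LinearMap.ker (ContinuousLinearMap.id ℝ (L2Mat Ω) + onL2 Ω (transp d)).toLinearMap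

instance {d : ℕ} (Ω : Set (Vec d)) : CompleteSpace (SkewL2 Ω) :=
  ((ContinuousLinearMap.id ℝ (L2Mat Ω) + onL2 Ω (transp d)).isClosed_ker).completeSpace_coe

/-! ### Functions of time -/

/-- Membership in `L²(0, T; V)`. -/
def MemL2Time {V : Type*} [NormedAddCommGroup V] (T : ℝ) (f : ℝ → V) : Prop :=
  MemLp f 2 (volume.restrict (Ioo 0 T))

/-- `f ∈ H¹(0, T; V)` with derivative `g`: `g ∈ L²(0, T; V)` and `f(t) = f(0) + ∫₀ᵗ g` for all
`t ∈ [0, T]`. -/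
def HasTimeDeriv {V : Type*} [NormedAddCommGroup V] [NormedSpace ℝ V] (T : ℝ) (f g : ℝ → V) :
    Prop :=
  MemL2Time T g ∧ ∀ t ∈ Icc 0 T, f t = f 0 + ∫ s in (0 : ℝ)..t, g s

/-- The class of `f` modulo null sets of times belongs to `H¹(0, T; V)`, that is, `f` has a
distributional derivative in `L²(0, T; V)`. -/
def MemH1Time {V : Type*} [NormedAddCommGroup V] [NormedSpace ℝ V] (T : ℝ) (f : ℝ → V) : Prop :=
  ∃ fc g : ℝ → V, (∀ᵐ t ∂(volume.restrict (Ioo 0 T)), fc t = f t) ∧ HasTimeDeriv T fc g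

/-! ### The Zener model -/

/-- The data of a composite elastic-viscoelastic body: a polyhedral Lipschitz domain `Ω`, its
partition into polyhedral subdomains, the density and the relaxation time on each of them, the
tensors of the constitutive law and the final time. -/
structure Model (d : ℕ) where
  Ω : Set (Vec d)
  bounded : Bornology.IsBounded Ω
  polyhedral : IsPolyhedralDomain Ω
  lipschitz : HasLipschitzBoundary Ω
  J : ℕ
  sub : Fin J → Set (Vec d)
  sub_polyhedral : ∀ j, IsPolyhedralDomain (sub j)
  sub_disjoint : Pairwise fun i j => Disjoint (sub i) (sub j)
  sub_cover : closure Ω = ⋃ j, closure (sub j)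
  ρ : Fin J → ℝ
  ρ_pos : ∀ j, 0 < ρ j
  ω : Fin J → ℝ
  ω_nonneg : ∀ j, 0 ≤ ω j
  C : Mat d →L[ℝ] Mat d
  C_symm : IsSymmTensor C
  C_posDef : IsPosDefTensor C
  C_preserves : PreservesSymm C
  D : Mat d →L[ℝ] Mat d
  D_symm : IsSymmTensor D
  D_posDef : IsPosDefTensor D
  D_preserves : PreservesSymm D
  diff_posDef : IsPosDefTensor (D - C)
  T : ℝ
  T_pos : 0 < T

namespace Model

variable {d : ℕ} (m : Model d)

/-- The piecewise constant function with value `c j` on the `j`-th subdomain (and `0` on the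
interfaces, which are null sets). -/
def piecewise (c : Fin m.J → ℝ) (x : Vec d) : ℝ :=
  ∑ j, (m.sub j).indicator (fun _ => c j) x

theorem isOpen_sub (j : Fin m.J) : IsOpen (m.sub j) := by
  rw [← (m.sub_polyhedral j).regular]
  exact isOpen_interior

theorem memLp_piecewise (c : Fin m.J → ℝ) :
    MemLp (m.piecewise c) ∞ (volume.restrict m.Ω) := by
  unfold piecewise
  refine memLp_finsetSum _ fun j _ => ?_
  exact (memLp_top_const (c j)).indicator (m.isOpen_sub j).measurableSet

/-- Multiplication of fields in `L²(Ω)` by the piecewise constant function with values `c j`. -/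
def mul (c : Fin m.J → ℝ) (W : Type) [NormedAddCommGroup W] [NormedSpace ℝ W] :
    Lp W 2 (volume.restrict m.Ω) →L[ℝ] Lp W 2 (volume.restrict m.Ω) :=
  (ContinuousLinearMap.lsmul ℝ ℝ : ℝ →L[ℝ] W →L[ℝ] W).holderL (volume.restrict m.Ω) ∞ 2 2
    ((m.memLp_piecewise c).toLp _)

/-- Multiplication by `1/ρ`. -/
def divRho : L2Vec m.Ω →L[ℝ] L2Vec m.Ω := m.mul (fun j => (m.ρ j)⁻¹) (Vec d)

/-- Multiplication by `ω`. -/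
def mulOmega : L2Mat m.Ω →L[ℝ] L2Mat m.Ω := m.mul m.ω (Mat d)

/-- Multiplication by the function equal to `1/ω` where `ω ≠ 0` and to `0` where `ω = 0`. -/
def divOmega : L2Mat m.Ω →L[ℝ] L2Mat m.Ω :=
  m.mul (fun j => if m.ω j = 0 then 0 else (m.ω j)⁻¹) (Mat d)

/-- Multiplication by the indicator function of the elastic part `Ω_E`, where `ω = 0`. -/
def onElastic : L2Mat m.Ω →L[ℝ] L2Mat m.Ω :=
  m.mul (fun j => if m.ω j = 0 then 1 else 0) (Mat d)

/-- The compliance tensor `C⁻¹`. -/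
def tensorA : Mat d →L[ℝ] Mat d := m.C.inverse

/-- The tensor `(D - C)⁻¹`. -/
def tensorV : Mat d →L[ℝ] Mat d := (m.D - m.C).inverse

/-- The bilinear form `A((γ, ζ), (η, τ)) = (C⁻¹γ, η) + ((D - C)⁻¹ζ, τ)`. -/
def formA (p q : PairL2 m.Ω) : ℝ :=
  ⟪onL2 m.Ω m.tensorA p.fst, q.fst⟫ + ⟪onL2 m.Ω m.tensorV p.snd, q.snd⟫

/-- The weighted inner product `(u, v)_ρ = (u/ρ, v)`. -/
def innerRho (u v : L2Vec m.Ω) : ℝ := ⟪m.divRho u, v⟫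

/-- `(η, τ) ↦ (η, ωτ)`. -/
def jOmega (q : PairL2 m.Ω) : PairL2 m.Ω := WithLp.toLp 2 (q.fst, m.mulOmega q.snd)

/-- `(η, τ) ↦ η + ωτ`, the total stress. -/
def jPlus : PairL2 m.Ω →L[ℝ] L2Mat m.Ω :=
  WithLp.fstL 2 ℝ (L2Mat m.Ω) (L2Mat m.Ω) +
    m.mulOmega.comp (WithLp.sndL 2 ℝ (L2Mat m.Ω) (L2Mat m.Ω))

/-- `(η, τ) ↦ (0, τ)`. -/
def pi2 (q : PairL2 m.Ω) : PairL2 m.Ω := WithLp.toLp 2 (0, q.snd)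

/-- `S`: the pairs `q = (η, τ)` such that `τ` vanishes on `Ω_E` and the weak divergence of `η + ωτ`
belongs to `L²(Ω)^d`. Elements are stored as `(q, div (η + ωτ))`; the resulting norm
`(‖η‖² + ‖τ‖² + ‖div (η + ωτ)‖²)^{1/2}` is equivalent to the one with `‖ωτ‖` instead of `‖τ‖`, because
`ω` is bounded and bounded away from `0` outside `Ω_E`. -/
def S : Submodule ℝ (WithLp 2 (PairL2 m.Ω × L2Vec m.Ω)) where
  carrier := {s | m.onElastic s.fst.snd = 0 ∧ HasWeakDiv (m.jPlus s.fst) s.snd}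
  zero_mem' := by
    constructor
    · simp
    · intro φ; simp
  add_mem' := by
    intro a b ha hb
    refine ⟨?_, fun φ => ?_⟩
    · simp [ha.1, hb.1]
    · have h1 := ha.2 φ
      have h2 := hb.2 φ
      simp only [WithLp.add_fst, WithLp.add_snd, map_add, inner_add_left] at *
      linarith
  smul_mem' := by
    intro c a ha
    refine ⟨?_, fun φ => ?_⟩
    · simp [ha.1]
    · have h1 := ha.2 φ
      simp only [WithLp.smul_fst, WithLp.smul_snd, map_smul, real_inner_smul_left] at *
      rw [h1]; ring

/-- `S_sym`: the elements of `S` for which `η + ωτ` is symmetric. -/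
def SSym : Submodule ℝ (WithLp 2 (PairL2 m.Ω × L2Vec m.Ω)) where
  carrier := {s | s ∈ m.S ∧ onL2 m.Ω (transp d) (m.jPlus s.fst) = m.jPlus s.fst}
  zero_mem' := ⟨m.S.zero_mem, by simp⟩
  add_mem' := by
    intro a b ha hb
    exact ⟨m.S.add_mem ha.1 hb.1, by simp [ha.2, hb.2]⟩
  smul_mem' := by
    intro c a ha
    exact ⟨m.S.smul_mem c ha.1, by simp [ha.2]⟩

theorem isClosed_S : IsClosed (m.S : Set (WithLp 2 (PairL2 m.Ω × L2Vec m.Ω))) := by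
  have : (m.S : Set (WithLp 2 (PairL2 m.Ω × L2Vec m.Ω))) =
      {s | m.onElastic s.fst.snd = 0} ∩ ⋂ φ : TestField m.Ω (Vec d),
        {s | ⟪m.jPlus s.fst, φ.gradL2⟫ = -⟪s.snd, φ.toL2⟫} := by
    ext s
    simp [S, HasWeakDiv]
  rw [this]
  exact (isClosed_eq (by fun_prop) (by fun_prop)).inter
    (isClosed_iInter fun φ => isClosed_eq (by fun_prop) (by fun_prop))

theorem isClosed_SSym : IsClosed (m.SSym : Set (WithLp 2 (PairL2 m.Ω × L2Vec m.Ω))) := by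
  have : (m.SSym : Set (WithLp 2 (PairL2 m.Ω × L2Vec m.Ω))) =
      (m.S : Set (WithLp 2 (PairL2 m.Ω × L2Vec m.Ω))) ∩ {s | onL2 m.Ω (transp d) (m.jPlus s.fst) = m.jPlus s.fst} := rfl
  rw [this]
  exact m.isClosed_S.inter (isClosed_eq (by fun_prop) (by fun_prop))

instance : CompleteSpace m.S := m.isClosed_S.completeSpace_coe

instance : CompleteSpace m.SSym := m.isClosed_SSym.completeSpace_coe

/-- The pair `(η, τ)` underlying an element of `S_sym`. -/
def symPair (s : m.SSym) : PairL2 m.Ω := s.1.fst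

/-- `div (η + ωτ)` for an element `(η, τ)` of `S_sym`. -/
def symDiv (s : m.SSym) : L2Vec m.Ω := s.1.snd

/-- The identification of `q ∈ L²(Ω)^{d×d} × L²(Ω)^{d×d}` with the functional `s ↦ (q, s)` in the
dual of `S_sym`. -/
def toDual (q : PairL2 m.Ω) : m.SSym →L[ℝ] ℝ :=
  (innerSL ℝ q).comp ((WithLp.fstL 2 ℝ (PairL2 m.Ω) (L2Vec m.Ω)).comp m.SSym.subtypeL)

/-- `⟨b, (η + ωτ) n⟩_Γ` for `(η, τ) ∈ S` and `b ∈ H^{1/2}(Γ)^d`. -/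
def boundaryTerm (b : TraceSpace m.Ω) (q : m.S) : ℝ :=
  normalPairing (m.jPlus q.1.fst) q.1.snd q.2.2 b

/-- The initial value `p₀ = (γ₀, ζ₀)`, `γ₀ = C ε(u₀)`, `ζ₀ = ω̃⁻¹ (σ₀ - γ₀)`. -/
def initPair (u₀ : H1 m.Ω) (σ₀ : L2Mat m.Ω) : PairL2 m.Ω :=
  WithLp.toLp 2 (onL2 m.Ω m.C (H1.strain u₀), m.divOmega (σ₀ - onL2 m.Ω m.C (H1.strain u₀)))

/-- The initial velocity `p₁ = (γ₁, ζ₁)`, `γ₁ = C ε(u₁)`, `ζ₁ = ω̃⁻¹ (D ε(u₁) - γ₁ - ζ₀)`. -/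
def initPairDot (u₀ u₁ : H1 m.Ω) (σ₀ : L2Mat m.Ω) : PairL2 m.Ω :=
  WithLp.toLp 2 (onL2 m.Ω m.C (H1.strain u₁),
    m.divOmega (onL2 m.Ω m.D (H1.strain u₁) - onL2 m.Ω m.C (H1.strain u₁) - (m.initPair u₀ σ₀).snd))

/-- The mixed problem with weakly imposed symmetry. Here `F` is the body force, `gdd` is the second
time derivative of the boundary displacement, `p` the pair of stress components, `pd` its time
derivative and `r` the Lagrange multiplier.

The fields `deriv` and `velocity` say that `p` belongs to `W(S_sym, S_sym')`, that is,
`p ∈ H¹(S_sym)` and the derivative of `pd` in time, taken in the dual of `S_sym`, is in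
`L²(S_sym')`; the initial condition for `pd` holds for its continuous representative with values
in this dual. The field `equation` is the variational equation in the sense of distributions
on `(0, T)`. -/
structure IsSolution (F : ℝ → L2Vec m.Ω) (gdd : ℝ → TraceSpace m.Ω) (u₀ u₁ : H1 m.Ω)
    (σ₀ : L2Mat m.Ω) (p pd : ℝ → m.SSym) (r : ℝ → SkewL2 m.Ω) : Prop where
  memL2 : MemL2Time m.T p
  deriv : HasTimeDeriv m.T p pd
  velocity : ∃ f φ : ℝ → (m.SSym →L[ℝ] ℝ),
    (∀ᵐ t ∂(volume.restrict (Ioo 0 m.T)), f t = m.toDual (m.symPair (pd t))) ∧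
      HasTimeDeriv m.T f φ ∧ f 0 = m.toDual (m.initPairDot u₀ u₁ σ₀)
  init : m.symPair (p 0) = m.initPair u₀ σ₀
  continuous_r : ContinuousOn r (Icc 0 m.T)
  init_r : r 0 = 0
  equation : ∀ q : m.S, ∀ ψ : ℝ → ℝ, ContDiff ℝ (⊤ : ℕ∞) ψ → HasCompactSupport ψ →
    tsupport ψ ⊆ Ioo 0 m.T →
      -(∫ t in Ioo 0 m.T, _root_.deriv ψ t *
          (m.formA (m.jOmega (m.symPair (pd t)) + m.pi2 (m.symPair (p t))) (m.jOmega q.1.fst)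
            + ⟪(r t : L2Mat m.Ω), m.jPlus q.1.fst⟫))
        + ∫ t in Ioo 0 m.T, ψ t * m.innerRho (m.symDiv (p t)) q.1.snd
      = ∫ t in Ioo 0 m.T, ψ t * (-m.innerRho (F t) q.1.snd + m.boundaryTerm (gdd t) q)
  symmetry : ∀ t ∈ Icc 0 m.T, ∀ s : SkewL2 m.Ω,
    ⟪(s : L2Mat m.Ω), m.jPlus (m.symPair (p t))⟫ = 0

/-- The displacement field `u ∈ H²(0, T; L²(Ω)^d)` associated with the stress, with first and second
time derivatives `ud` and `udd`: it satisfies `ρ ü = F + div (γ + ωζ)`, `u(0) = u₀`,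
`u̇(0) = u₁`. -/
structure IsDisplacement (F : ℝ → L2Vec m.Ω) (u₀ u₁ : H1 m.Ω) (p : ℝ → m.SSym)
    (u ud udd : ℝ → L2Vec m.Ω) : Prop where
  deriv : HasTimeDeriv m.T u ud
  deriv2 : HasTimeDeriv m.T ud udd
  motion : ∀ᵐ t ∂(volume.restrict (Ioo 0 m.T)), udd t = m.divRho (F t + m.symDiv (p t))
  init : u 0 = H1.value u₀
  initDot : ud 0 = H1.value u₁

end Model

end Zener

end

/-!
Let `x = (γ', ζ')` be the continuous representative of `ṗ`. Tested with a smooth compactly supported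
`q = (Ψ, 0)` the boundary term of the mixed problem vanishes, since the normal pairing of such a
field with any element of `H¹` is the defining identity of the weak gradient. After integration by
parts in time and the substitution `ρ ü = F + div (γ + ωζ)`, the equation reads
`(C⁻¹ γ'' + r', Ψ) = -(ü, div Ψ)` for almost every `t` (`Model.IsSolution.ae_equation`). Thus `ü` has
the weak gradient `C⁻¹ γ'' + r'` (`Model.IsSolution.ae_hasWeakGrad_acceleration`). Integrating in
time, `u̇(t)` has the gradient `∇u₁ + C⁻¹ (γ'(t) - γ'(0)) + r(t)`, and its skew part is the asserted
one as soon as `γ'(t) - γ'(0)` is symmetric (`Model.IsSolution.skew_fst_sub_eq_zero`).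

Only `γ + ωζ` is known to be symmetric, so that the symmetry of the increments of `γ'` needs an
argument. Testing with `q = (-ωτ, τ)`, for which the total stress and hence the divergence, multiplier
and boundary terms vanish, gives the constitutive law (`Model.IsSolution.constitutive`)
`(D - C)⁻¹ (ω δζ' + δζ) = C⁻¹ δγ'` outside the elastic part, where `δ` denotes increments over
`(0, t)`. The tensors commute with taking skew parts. With `a = skew δγ'` and `c = skew δζ` one has
`ω skew δζ' = -a`, so the law becomes `a = C D⁻¹ c` (`Model.skew_fst_eq_of_constitutive`). The initial
condition for `ṗ`, although it is an identity of functionals on `S_sym` only, yields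
`skew ζ'(0) = 0` (`Model.IsSolution.skew_snd_zero`). Hence `c' = skew ζ' = -ω̃⁻¹ C D⁻¹ c`, a linear
evolution equation with a bounded operator and `c(0) = 0`, so `c = 0` and `a = 0`.
-/

noncomputable section

namespace Zener

/-! ### Constant fourth order tensors -/

section Tensors

variable {d : ℕ}

theorem transp_transp (τ : Mat d) : transp d (transp d τ) = τ := rfl

theorem isSymmTensor_transp : IsSymmTensor (transp d) := by
  intro σ τ
  simp only [PiLp.inner_apply, Fintype.sum_prod_type, transp_apply]
  exact Finset.sum_comm

theorem isSymmTensor_skewPart : IsSymmTensor (skewPart d) := by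
  intro σ τ
  have h := isSymmTensor_transp σ τ
  simp only [skewPart, smul_apply, sub_apply,
    ContinuousLinearMap.id_apply, real_inner_smul_left, real_inner_smul_right, inner_sub_left,
    inner_sub_right, h]

/-- A symmetric tensor that preserves symmetric matrices also preserves their orthogonal
complement, the skew-symmetric matrices; hence it commutes with transposition. -/
theorem IsSymmTensor.transp_comm {C : Mat d →L[ℝ] Mat d} (hC : IsSymmTensor C)
    (hs : PreservesSymm C) (σ : Mat d) : transp d (C σ) = C (transp d σ) := by
  have hsym := hs (σ + transp d σ) (by simp [transp_transp, add_comm])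
  have hskew : C (σ - transp d σ) + transp d (C (σ - transp d σ)) = 0 := by
    set k := C (σ - transp d σ) with hk
    have h0 : ⟪k, k + transp d k⟫ = 0 := by
      have h1 := hs (k + transp d k) (by simp [transp_transp, add_comm])
      rw [hk, hC, ← hk, inner_sub_left, isSymmTensor_transp σ, h1, sub_self]
    have h1 : ⟪transp d k, k + transp d k⟫ = 0 := by
      rw [isSymmTensor_transp, map_add, transp_transp, add_comm, h0]
    rw [← inner_self_eq_zero (𝕜 := ℝ), inner_add_left, h0, h1, add_zero]
  simp only [map_add, map_sub] at hsym hskew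
  have h2 : (2 : ℝ) • (transp d (C σ) - C (transp d σ)) = 0 := by
    rw [two_smul]
    have e1 := sub_eq_zero.mpr hsym
    calc _ = (transp d (C σ) + transp d (C (transp d σ)) - (C σ + C (transp d σ)))
          + (C σ - C (transp d σ) + (transp d (C σ) - transp d (C (transp d σ)))) := by abel
      _ = 0 := by rw [e1, hskew, add_zero]
  exact sub_eq_zero.mp ((smul_eq_zero.mp h2).resolve_left two_ne_zero)

theorem IsSymmTensor.skewPart_comp {C : Mat d →L[ℝ] Mat d} (hC : IsSymmTensor C)
    (hs : PreservesSymm C) : (skewPart d).comp C = C.comp (skewPart d) := by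
  ext1 σ
  simp [skewPart, hC.transp_comm hs]

theorem IsPosDefTensor.exists_equiv {C : Mat d →L[ℝ] Mat d} (hC : IsPosDefTensor C) :
    ∃ e : Mat d ≃L[ℝ] Mat d, (e : Mat d →L[ℝ] Mat d) = C := by
  have hinj : Function.Injective C.toLinearMap := by
    rw [injective_iff_map_eq_zero]
    intro σ hσ
    by_contra hne
    have := hC σ hne
    rw [ContinuousLinearMap.coe_coe] at hσ
    simp [hσ] at this
  refine ⟨(LinearEquiv.ofInjectiveEndo C.toLinearMap hinj).toContinuousLinearEquiv, ?_⟩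
  ext1 σ
  rfl

theorem IsPosDefTensor.inverse_comp {C : Mat d →L[ℝ] Mat d} (hC : IsPosDefTensor C) :
    C.inverse.comp C = ContinuousLinearMap.id ℝ (Mat d) := by
  obtain ⟨e, rfl⟩ := hC.exists_equiv
  ext1 σ
  simp

theorem IsPosDefTensor.comp_inverse {C : Mat d →L[ℝ] Mat d} (hC : IsPosDefTensor C) :
    C.comp C.inverse = ContinuousLinearMap.id ℝ (Mat d) := by
  obtain ⟨e, rfl⟩ := hC.exists_equiv
  ext1 σ
  simp

theorem IsPosDefTensor.commute_inverse {C K : Mat d →L[ℝ] Mat d} (hC : IsPosDefTensor C)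
    (h : K.comp C = C.comp K) : K.comp C.inverse = C.inverse.comp K := by
  calc K.comp C.inverse = (C.inverse.comp C).comp (K.comp C.inverse) := by
        rw [hC.inverse_comp, ContinuousLinearMap.id_comp]
    _ = C.inverse.comp ((C.comp K).comp C.inverse) := by
        simp only [ContinuousLinearMap.comp_assoc]
    _ = (C.inverse.comp K).comp (C.comp C.inverse) := by
        rw [← h]; simp only [ContinuousLinearMap.comp_assoc]
    _ = C.inverse.comp K := by rw [hC.comp_inverse, ContinuousLinearMap.comp_id]

end Tensors

/-! ### Tensors acting on square integrable fields -/

section OnL2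

variable {d : ℕ} {Ω : Set (Vec d)}

theorem onL2_ae (C : Mat d →L[ℝ] Mat d) (f : L2Mat Ω) :
    onL2 Ω C f =ᵐ[volume.restrict Ω] fun x => C (f x) :=
  C.coeFn_compLpL f

theorem onL2_comp (C D : Mat d →L[ℝ] Mat d) (f : L2Mat Ω) :
    onL2 Ω (C.comp D) f = onL2 Ω C (onL2 Ω D f) := by
  apply Lp.ext
  filter_upwards [onL2_ae (C.comp D) f, onL2_ae C (onL2 Ω D f), onL2_ae D f] with x h1 h2 h3
  rw [h1, h2, h3]; rfl

theorem onL2_id (f : L2Mat Ω) : onL2 Ω (ContinuousLinearMap.id ℝ (Mat d)) f = f := by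
  apply Lp.ext
  filter_upwards [onL2_ae (ContinuousLinearMap.id ℝ (Mat d)) f] with x h1
  rw [h1]; rfl

theorem onL2_add (C D : Mat d →L[ℝ] Mat d) (f : L2Mat Ω) :
    onL2 Ω (C + D) f = onL2 Ω C f + onL2 Ω D f := by
  rw [onL2, ContinuousLinearMap.add_compLpL]; rfl

theorem onL2_smul (c : ℝ) (C : Mat d →L[ℝ] Mat d) (f : L2Mat Ω) :
    onL2 Ω (c • C) f = c • onL2 Ω C f := by
  rw [onL2, ContinuousLinearMap.smul_compLpL]; rfl

theorem onL2_sub (C D : Mat d →L[ℝ] Mat d) (f : L2Mat Ω) :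
    onL2 Ω (C - D) f = onL2 Ω C f - onL2 Ω D f := by
  rw [eq_sub_iff_add_eq, ← onL2_add, sub_add_cancel]

theorem onL2_comm {C D : Mat d →L[ℝ] Mat d} (h : C.comp D = D.comp C) (f : L2Mat Ω) :
    onL2 Ω C (onL2 Ω D f) = onL2 Ω D (onL2 Ω C f) := by
  rw [← onL2_comp, h, onL2_comp]

theorem IsSymmTensor.inner_onL2 {C : Mat d →L[ℝ] Mat d} (hC : IsSymmTensor C) (f g : L2Mat Ω) :
    ⟪onL2 Ω C f, g⟫ = ⟪f, onL2 Ω C g⟫ := by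
  rw [L2.inner_def, L2.inner_def]
  refine integral_congr_ae ?_
  filter_upwards [onL2_ae C f, onL2_ae C g] with x h1 h2
  rw [h1, h2, hC]

theorem IsPosDefTensor.onL2_inverse_onL2 {C : Mat d →L[ℝ] Mat d} (hC : IsPosDefTensor C)
    (f : L2Mat Ω) : onL2 Ω C.inverse (onL2 Ω C f) = f := by
  rw [← onL2_comp, hC.inverse_comp, onL2_id]

theorem IsPosDefTensor.onL2_onL2_inverse {C : Mat d →L[ℝ] Mat d} (hC : IsPosDefTensor C)
    (f : L2Mat Ω) : onL2 Ω C (onL2 Ω C.inverse f) = f := by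
  rw [← onL2_comp, hC.comp_inverse, onL2_id]

theorem skew_onL2_eq (f : L2Mat Ω) :
    onL2 Ω (skewPart d) f = (1 / 2 : ℝ) • (f - onL2 Ω (transp d) f) := by
  rw [skewPart, onL2_smul, onL2_sub, onL2_id]

theorem skew_onL2_eq_zero {f : L2Mat Ω} (hf : onL2 Ω (transp d) f = f) :
    onL2 Ω (skewPart d) f = 0 := by
  rw [skew_onL2_eq, hf, sub_self, smul_zero]

theorem skew_onL2_of_mem_SkewL2 {f : L2Mat Ω} (hf : f ∈ SkewL2 Ω) :
    onL2 Ω (skewPart d) f = f := by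
  have h : f + onL2 Ω (transp d) f = 0 := hf
  rw [skew_onL2_eq, ← neg_eq_of_add_eq_zero_right h, sub_neg_eq_add, ← two_smul ℝ, smul_smul]
  norm_num

theorem skewPart_comp_skewPart : (skewPart d).comp (skewPart d) = skewPart d := by
  ext1 σ
  simp only [skewPart, ContinuousLinearMap.comp_apply, smul_apply, sub_apply,
    ContinuousLinearMap.id_apply, map_smul, map_sub, transp_transp]
  module

theorem H1.skew_strain (h : H1 Ω) : onL2 Ω (skewPart d) (H1.strain h) = 0 := by
  apply skew_onL2_eq_zero
  rw [H1.strain, ← onL2_comp]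
  congr 1
  congr 1
  ext1 σ
  simp [symPart, transp_transp, add_comm]

end OnL2

/-! ### Multiplication by piecewise constant functions -/

theorem IsPolyhedralDomain.isOpen {d : ℕ} {U : Set (Vec d)} (hU : IsPolyhedralDomain U) :
    IsOpen U := by
  rw [← hU.regular]; exact isOpen_interior

theorem frontier_biUnion_finset_subset {X ι : Type*} [TopologicalSpace X] (P : Finset ι)
    (s : ι → Set X) : frontier (⋃ i ∈ P, s i) ⊆ ⋃ i ∈ P, frontier (s i) := by
  classical
  induction P using Finset.induction_on with
  | empty => simp
  | insert a P _ ih =>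
    rw [Finset.set_biUnion_insert, Finset.set_biUnion_insert]
    refine (frontier_union_subset _ _).trans ?_
    exact union_subset_union inter_subset_left (inter_subset_right.trans ih)

/-- The closure of a polyhedral domain exceeds the domain by the frontier of a finite union of
convex sets, which is a null set. -/
theorem IsPolyhedralDomain.volume_closure_diff {d : ℕ} {U : Set (Vec d)}
    (hU : IsPolyhedralDomain U) : volume (closure U \ U) = 0 := by
  obtain ⟨P, hP⟩ := hU.polyhedral
  have h : closure U \ U ⊆ ⋃ V ∈ P, frontier (convexHull ℝ (V : Set (Vec d))) := by
    refine Subset.trans ?_ (frontier_biUnion_finset_subset P _)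
    rw [← hP, isClosed_closure.frontier_eq, hU.regular]
  refine measure_mono_null h ?_
  exact (measure_biUnion_null_iff P.countable_toSet).mpr fun V _ =>
    (convex_convexHull ℝ _).addHaar_frontier volume

namespace Model

variable {d : ℕ} (m : Model d) {W : Type} [NormedAddCommGroup W] [NormedSpace ℝ W]

theorem piecewise_of_mem (c : Fin m.J → ℝ) {j : Fin m.J} {x : Vec d} (hx : x ∈ m.sub j) :
    m.piecewise c x = c j := by
  rw [piecewise, Finset.sum_eq_single j]
  · exact indicator_of_mem hx _
  · intro i _ hij
    exact indicator_of_notMem (fun hi => disjoint_left.mp (m.sub_disjoint hij) hi hx) _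
  · simp

/-- The interfaces between the subdomains are null sets. -/
theorem ae_exists_mem_sub : ∀ᵐ x ∂(volume.restrict m.Ω), ∃ j, x ∈ m.sub j := by
  have h : ∀ᵐ x : Vec d, ∀ j, x ∉ closure (m.sub j) \ m.sub j :=
    ae_all_iff.mpr fun j =>
      measure_eq_zero_iff_ae_notMem.mp (m.sub_polyhedral j).volume_closure_diff
  rw [ae_restrict_iff' m.polyhedral.isOpen.measurableSet]
  filter_upwards [h] with x hx hxΩ
  have : x ∈ ⋃ j, closure (m.sub j) := m.sub_cover ▸ subset_closure hxΩ
  obtain ⟨j, hj⟩ := mem_iUnion.mp this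
  exact ⟨j, by_contra fun hn => hx j ⟨hj, hn⟩⟩

theorem mul_ae (c : Fin m.J → ℝ) (f : Lp W 2 (volume.restrict m.Ω)) :
    ∀ᵐ x ∂(volume.restrict m.Ω), m.mul c W f x = m.piecewise c x • f x := by
  have h1 := ContinuousLinearMap.coeFn_holder (μ := volume.restrict m.Ω) (r := 2)
    (ContinuousLinearMap.lsmul ℝ ℝ : ℝ →L[ℝ] W →L[ℝ] W) ((m.memLp_piecewise c).toLp _) f
  filter_upwards [h1, (m.memLp_piecewise c).coeFn_toLp] with x h1 h2
  rw [mul, ContinuousLinearMap.holderL_apply_apply, h1, h2]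
  rfl

theorem mul_ae_sub (c : Fin m.J → ℝ) (f : Lp W 2 (volume.restrict m.Ω)) :
    ∀ᵐ x ∂(volume.restrict m.Ω), ∀ j, x ∈ m.sub j → m.mul c W f x = c j • f x := by
  filter_upwards [m.mul_ae c f] with x h1 j hj
  rw [h1, m.piecewise_of_mem c hj]

theorem mul_mul (c c' : Fin m.J → ℝ) (f : Lp W 2 (volume.restrict m.Ω)) :
    m.mul c W (m.mul c' W f) = m.mul (c * c') W f := by
  apply Lp.ext
  filter_upwards [m.ae_exists_mem_sub, m.mul_ae_sub c (m.mul c' W f), m.mul_ae_sub c' f,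
    m.mul_ae_sub (c * c') f] with x ⟨j, hj⟩ h1 h2 h3
  rw [h1 j hj, h2 j hj, h3 j hj, smul_smul, Pi.mul_apply]

theorem mul_one' (f : Lp W 2 (volume.restrict m.Ω)) : m.mul 1 W f = f := by
  apply Lp.ext
  filter_upwards [m.ae_exists_mem_sub, m.mul_ae_sub 1 f] with x ⟨j, hj⟩ h1
  rw [h1 j hj, Pi.one_apply, one_smul]

theorem mul_zero' (f : Lp W 2 (volume.restrict m.Ω)) : m.mul 0 W f = 0 := by
  apply Lp.ext
  filter_upwards [m.ae_exists_mem_sub, m.mul_ae_sub 0 f, Lp.coeFn_zero W 2 (volume.restrict m.Ω)]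
    with x ⟨j, hj⟩ h1 h2
  rw [h1 j hj, h2, Pi.zero_apply, zero_smul, Pi.zero_apply]

theorem mul_add' (c c' : Fin m.J → ℝ) (f : Lp W 2 (volume.restrict m.Ω)) :
    m.mul (c + c') W f = m.mul c W f + m.mul c' W f := by
  apply Lp.ext
  filter_upwards [m.ae_exists_mem_sub, m.mul_ae_sub c f, m.mul_ae_sub c' f,
    m.mul_ae_sub (c + c') f, Lp.coeFn_add (m.mul c W f) (m.mul c' W f)] with x ⟨j, hj⟩ h1 h2 h3 h4
  rw [h4, h3 j hj, Pi.add_apply, Pi.add_apply, h1 j hj, h2 j hj, add_smul]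

theorem inner_mul {V : Type} [NormedAddCommGroup V] [InnerProductSpace ℝ V] (c : Fin m.J → ℝ)
    (f g : Lp V 2 (volume.restrict m.Ω)) : ⟪m.mul c V f, g⟫ = ⟪f, m.mul c V g⟫ := by
  rw [L2.inner_def, L2.inner_def]
  refine integral_congr_ae ?_
  filter_upwards [m.mul_ae c f, m.mul_ae c g] with x h1 h2
  rw [h1, h2, real_inner_smul_left, real_inner_smul_right]

theorem onL2_mul (c : Fin m.J → ℝ) (C : Mat d →L[ℝ] Mat d) (f : L2Mat m.Ω) :
    onL2 m.Ω C (m.mul c (Mat d) f) = m.mul c (Mat d) (onL2 m.Ω C f) := by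
  apply Lp.ext
  filter_upwards [m.mul_ae c f, m.mul_ae c (onL2 m.Ω C f), onL2_ae C (m.mul c (Mat d) f),
    onL2_ae C f] with x h1 h2 h3 h4
  rw [h3, h1, h2, h4, map_smul]

theorem onElastic_mulOmega (f : L2Mat m.Ω) : m.onElastic (m.mulOmega f) = 0 := by
  rw [onElastic, mulOmega, mul_mul, ← m.mul_zero' f]
  congr 2
  ext j
  by_cases h : m.ω j = 0 <;> simp [h]

theorem onElastic_divOmega (f : L2Mat m.Ω) : m.onElastic (m.divOmega f) = 0 := by
  rw [onElastic, divOmega, mul_mul, ← m.mul_zero' f]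
  congr 2
  ext j
  by_cases h : m.ω j = 0 <;> simp [h]

theorem onElastic_add_divOmega_mulOmega (f : L2Mat m.Ω) :
    m.onElastic f + m.divOmega (m.mulOmega f) = f := by
  rw [onElastic, divOmega, mulOmega, mul_mul, ← mul_add']
  conv_rhs => rw [← m.mul_one' f]
  congr 2
  ext j
  by_cases h : m.ω j = 0 <;> simp [h]

theorem divOmega_mulOmega {f : L2Mat m.Ω} (hf : m.onElastic f = 0) :
    m.divOmega (m.mulOmega f) = f := by
  conv_rhs => rw [← m.onElastic_add_divOmega_mulOmega f, hf, zero_add]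

end Model

/-! ### Sobolev functions of time -/

section Time

variable {V W : Type*} [NormedAddCommGroup V] [NormedAddCommGroup W] {T : ℝ}

theorem MemL2Time.integrableOn {f : ℝ → V} (hf : MemL2Time T f) : IntegrableOn f (Ioo 0 T) :=
  hf.integrable one_le_two

theorem MemL2Time.intervalIntegrable {f : ℝ → V} (hf : MemL2Time T f) (hT : 0 ≤ T) :
    IntervalIntegrable f volume 0 T := by
  rw [intervalIntegrable_iff_integrableOn_Ioo_of_le hT]
  exact hf.integrableOn

theorem MemL2Time.intervalIntegrable_of_mem {f : ℝ → V} (hf : MemL2Time T f) {t : ℝ}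
    (ht : t ∈ Icc 0 T) : IntervalIntegrable f volume 0 t := by
  refine (hf.intervalIntegrable (ht.1.trans ht.2)).mono_set ?_
  rw [uIcc_of_le ht.1, uIcc_of_le (ht.1.trans ht.2)]
  exact Icc_subset_Icc_right ht.2

theorem MemL2Time.add {f g : ℝ → V} (hf : MemL2Time T f) (hg : MemL2Time T g) :
    MemL2Time T fun t => f t + g t :=
  MemLp.add hf hg

theorem MemL2Time.congr {f g : ℝ → V} (hf : MemL2Time T f)
    (h : ∀ᵐ t ∂(volume.restrict (Ioo 0 T)), f t = g t) : MemL2Time T g :=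
  (memLp_congr_ae h).mp hf

/-- Continuous functions on `[0, T]` that agree almost everywhere agree everywhere. -/
theorem eqOn_Icc_of_ae_eq {f g : ℝ → V} (hT : 0 < T) (hf : ContinuousOn f (Icc 0 T))
    (hg : ContinuousOn g (Icc 0 T))
    (h : ∀ᵐ t ∂(volume.restrict (Ioo 0 T)), f t = g t) {t : ℝ} (ht : t ∈ Icc 0 T) :
    f t = g t := by
  have h1 : ∀ᵐ t ∂(volume.restrict (Icc 0 T)), f t = g t := by
    rwa [← restrict_Ioo_eq_restrict_Icc]
  exact Measure.eqOn_Icc_of_ae_eq volume hT.ne h1 hf hg ht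

variable [NormedSpace ℝ V] [NormedSpace ℝ W]

theorem MemL2Time.clm_comp {f : ℝ → V} (hf : MemL2Time T f) (L : V →L[ℝ] W) :
    MemL2Time T fun t => L (f t) :=
  L.comp_memLp' hf

/-- Integrals over `(0, t)` only see the function on `(0, T)`. -/
theorem intervalIntegral_congr_time {f g : ℝ → V}
    (h : ∀ᵐ t ∂(volume.restrict (Ioo 0 T)), f t = g t) {t : ℝ} (ht : t ∈ Icc 0 T) :
    ∫ s in (0 : ℝ)..t, f s = ∫ s in (0 : ℝ)..t, g s := by
  rw [intervalIntegral.integral_of_le ht.1, intervalIntegral.integral_of_le ht.1,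
    ← restrict_Ioo_eq_restrict_Ioc]
  exact integral_congr_ae (ae_restrict_of_ae_restrict_of_subset (Ioo_subset_Ioo_right ht.2) h)

theorem HasTimeDeriv.continuousOn [CompleteSpace V] {f g : ℝ → V} (h : HasTimeDeriv T f g)
    (hT : 0 ≤ T) : ContinuousOn f (Icc 0 T) := by
  have h1 : ContinuousOn (fun t => f 0 + ∫ s in (0 : ℝ)..t, g s) (Icc 0 T) := by
    have h2 := intervalIntegral.continuousOn_primitive_interval
      (μ := volume) (f := g) (a := 0) (b := T) ?_
    · rw [uIcc_of_le hT] at h2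
      exact continuousOn_const.add h2
    · rw [uIcc_of_le hT, integrableOn_Icc_iff_integrableOn_Ioo]
      exact h.1.integrableOn
  exact h1.congr h.2

theorem HasTimeDeriv.congr_deriv {f g g' : ℝ → V} (h : HasTimeDeriv T f g)
    (hg : ∀ᵐ t ∂(volume.restrict (Ioo 0 T)), g t = g' t) : HasTimeDeriv T f g' :=
  ⟨h.1.congr hg, fun t ht => by rw [h.2 t ht, intervalIntegral_congr_time hg ht]⟩

theorem HasTimeDeriv.clm_comp [CompleteSpace V] [CompleteSpace W] {f g : ℝ → V}
    (h : HasTimeDeriv T f g) (L : V →L[ℝ] W) :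
    HasTimeDeriv T (fun t => L (f t)) fun t => L (g t) := by
  refine ⟨h.1.clm_comp L, fun t ht => ?_⟩
  beta_reduce
  rw [h.2 t ht, map_add, L.intervalIntegral_comp_comm (h.1.intervalIntegrable_of_mem ht)]

theorem HasTimeDeriv.add {f g f' g' : ℝ → V} (h : HasTimeDeriv T f g)
    (h' : HasTimeDeriv T f' g') : HasTimeDeriv T (fun t => f t + f' t) fun t => g t + g' t := by
  refine ⟨h.1.add h'.1, fun t ht => ?_⟩
  beta_reduce
  rw [h.2 t ht, h'.2 t ht, intervalIntegral.integral_add (h.1.intervalIntegrable_of_mem ht)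
    (h'.1.intervalIntegrable_of_mem ht)]
  abel

/-- Integration by parts in time against a test function. -/
theorem HasTimeDeriv.integral_deriv_mul {Y y : ℝ → ℝ} (h : HasTimeDeriv T Y y) (hT : 0 ≤ T)
    {ψ : ℝ → ℝ} (hψ : ContDiff ℝ (⊤ : ℕ∞) ψ) (hs : tsupport ψ ⊆ Ioo 0 T) :
    ∫ t in Ioo 0 T, deriv ψ t * Y t = -∫ t in Ioo 0 T, ψ t * y t := by
  have hy := h.1.intervalIntegrable hT
  set P : ℝ → ℝ := fun t => Y 0 + ∫ s in (0 : ℝ)..t, y s with hP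
  have hPac : AbsolutelyContinuousOnInterval P 0 T := by
    refine AbsolutelyContinuousOnInterval.add ?_
      (hy.absolutelyContinuousOnInterval_intervalIntegral (by simp))
    exact (contDiffOn_const (n := 1)).absolutelyContinuousOnInterval
  have hψac : AbsolutelyContinuousOnInterval ψ 0 T :=
    (hψ.of_le (by exact_mod_cast le_top) : ContDiff ℝ 1 ψ).contDiffOn.absolutelyContinuousOnInterval
  have hψ0 : ∀ t, t ∉ Ioo 0 T → ψ t = 0 := fun t ht =>
    image_eq_zero_of_notMem_tsupport fun h => ht (hs h)
  have hparts := hψac.integral_mul_deriv_eq_deriv_mul hPac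
  rw [hψ0 0 (by simp), hψ0 T (by simp)] at hparts
  have hder : ∀ᵐ t ∂(volume.restrict (Ioo 0 T)), deriv P t = y t := by
    rw [ae_restrict_iff' measurableSet_Ioo]
    filter_upwards [hy.ae_hasDerivAt_integral] with t ht hmem
    have hmem' : t ∈ uIcc 0 T := by rw [uIcc_of_le hT]; exact Ioo_subset_Icc_self hmem
    exact ((ht hmem' 0 (by simp)).const_add (Y 0)).deriv
  have e1 : ∫ t in (0 : ℝ)..T, ψ t * deriv P t = ∫ t in Ioo 0 T, ψ t * y t := by
    rw [intervalIntegral.integral_of_le hT, ← restrict_Ioo_eq_restrict_Ioc]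
    refine integral_congr_ae ?_
    filter_upwards [hder] with t ht
    rw [ht]
  have e2 : ∫ t in (0 : ℝ)..T, deriv ψ t * P t = ∫ t in Ioo 0 T, deriv ψ t * Y t := by
    rw [intervalIntegral.integral_of_le hT, ← restrict_Ioo_eq_restrict_Ioc]
    refine setIntegral_congr_fun measurableSet_Ioo fun t ht => ?_
    simp only [hP]
    rw [← h.2 t (Ioo_subset_Icc_self ht)]
  rw [e1, e2] at hparts
  linarith

/-- A function in `H¹(0, T)` that satisfies `Y' + Z = 0` in the sense of distributions satisfies
this equation almost everywhere. -/
theorem HasTimeDeriv.ae_eq_of_distrib {Y y Z : ℝ → ℝ} (h : HasTimeDeriv T Y y) (hT : 0 ≤ T)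
    (hZ : IntegrableOn Z (Ioo 0 T))
    (heq : ∀ ψ : ℝ → ℝ, ContDiff ℝ (⊤ : ℕ∞) ψ → HasCompactSupport ψ → tsupport ψ ⊆ Ioo 0 T →
      -(∫ t in Ioo 0 T, deriv ψ t * Y t) + ∫ t in Ioo 0 T, ψ t * Z t = 0) :
    ∀ᵐ t ∂(volume.restrict (Ioo 0 T)), y t + Z t = 0 := by
  rw [ae_restrict_iff' measurableSet_Ioo]
  have hint : IntegrableOn (fun t => y t + Z t) (Ioo 0 T) := h.1.integrableOn.add hZ
  refine isOpen_Ioo.ae_eq_zero_of_integral_contDiff_smul_eq_zero hint.locallyIntegrableOn ?_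
  intro ψ hψ hc hs
  have hψ0 : ∀ t, t ∉ Ioo 0 T → ψ t • (y t + Z t) = 0 := fun t ht => by
    rw [image_eq_zero_of_notMem_tsupport fun h => ht (hs h), zero_smul]
  rw [← setIntegral_eq_integral_of_forall_compl_eq_zero hψ0]
  obtain ⟨M, hM⟩ := hψ.continuous.bounded_above_of_compact_support hc
  have i1 : IntegrableOn (fun t => ψ t * y t) (Ioo 0 T) :=
    h.1.integrableOn.bdd_mul hψ.continuous.aestronglyMeasurable (ae_of_all _ hM)
  have i2 : IntegrableOn (fun t => ψ t * Z t) (Ioo 0 T) :=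
    hZ.bdd_mul hψ.continuous.aestronglyMeasurable (ae_of_all _ hM)
  have h1 := heq ψ hψ hc hs
  rw [h.integral_deriv_mul hT hψ hs, neg_neg] at h1
  simp only [smul_eq_mul, mul_add]
  rw [integral_add i1 i2, h1]

/-- Uniqueness for the linear evolution equation `c' = L c`, `c(0) = 0`, in integrated form. -/
theorem eq_zero_of_eq_integral_clm [CompleteSpace V] {c : ℝ → V} (L : V →L[ℝ] V) (hT : 0 < T)
    (hc : ContinuousOn c (Icc 0 T))
    (h : ∀ t ∈ Icc 0 T, c t = ∫ s in (0 : ℝ)..t, L (c s)) : ∀ t ∈ Icc 0 T, c t = 0 := by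
  have hLc : ContinuousOn (fun s => L (c s)) (Icc 0 T) := L.continuous.comp_continuousOn hc
  refine eq_zero_of_abs_deriv_le_mul_abs_self_of_eq_zero_right (f' := fun t => L (c t))
    (K := ‖L‖) hc ?_ ?_ fun t _ => L.le_opNorm _
  · intro t ht
    have hii : IntervalIntegrable (fun s => L (c s)) volume 0 t :=
      (hLc.mono (by rw [uIcc_of_le ht.1]; exact Icc_subset_Icc_right ht.2.le)).intervalIntegrable
    have hLIoo : ContinuousOn (fun s => L (c s)) (Ioo t T) :=
      hLc.mono fun s hs => ⟨ht.1.trans hs.1.le, hs.2.le⟩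
    have hmeas : StronglyMeasurableAtFilter (fun s => L (c s)) (nhdsWithin t (Ioi t)) :=
      (hLIoo.stronglyMeasurableAtFilter_nhdsWithin measurableSet_Ioo t).filter_mono
        (nhdsWithin_le_of_mem (Ioo_mem_nhdsGT ht.2))
    have hcw : ContinuousWithinAt (fun s => L (c s)) (Ici t) t :=
      (hLc t ⟨ht.1, ht.2.le⟩).mono_of_mem_nhdsWithin
        (Filter.mem_of_superset (Icc_mem_nhdsGE ht.2) (Icc_subset_Icc_left ht.1))
    have hd := intervalIntegral.integral_hasDerivWithinAt_right hii hmeas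
      (hcw.mono Ioi_subset_Ici_self) (s := Ici t)
    refine hd.congr_of_eventuallyEq ?_ (h t ⟨ht.1, ht.2.le⟩)
    filter_upwards [Icc_mem_nhdsGE ht.2] with s hs
    exact h s ⟨ht.1.trans hs.1, hs.2⟩
  · rw [h 0 ⟨le_rfl, hT.le⟩, intervalIntegral.integral_same]

end Time

/-! ### Test fields and weak derivatives -/

section TestFields

variable {d : ℕ} {Ω : Set (Vec d)}

/-- The `j`-th column of a matrix. -/
def column (d : ℕ) (j : Fin d) : Mat d →L[ℝ] Vec d :=
  LinearMap.toContinuousLinearMap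
    { toFun := fun M => WithLp.toLp 2 fun i => M (i, j)
      map_add' := fun M N => by ext i; simp
      map_smul' := fun c M => by ext i; simp }

theorem column_apply (j i : Fin d) (M : Mat d) : column d j M i = M (i, j) := rfl

theorem inner_grad (M : Mat d) (φ : Vec d → Vec d) (x : Vec d) :
    ⟪M, grad φ x⟫ = ∑ j, ⟪column d j M, partialDeriv φ j x⟫ := by
  simp only [PiLp.inner_apply, Fintype.sum_prod_type, column_apply, grad]
  exact Finset.sum_comm

theorem inner_diverg (Ψ : Vec d → Mat d) (v x : Vec d) :
    ⟪diverg Ψ x, v⟫ = ∑ j, ⟪column d j (partialDeriv Ψ j x), v⟫ := by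
  simp only [PiLp.inner_apply, column_apply, diverg]
  rw [Finset.sum_comm]
  refine Finset.sum_congr rfl fun i _ => ?_
  simp [Finset.mul_sum]

/-- The classical divergence of a test field is its weak divergence. -/
theorem TestField.hasWeakDiv (Ψ : TestField Ω (Mat d)) : HasWeakDiv Ψ.toL2 Ψ.divergL2 := by
  intro φ
  have hcol : ∀ j, Continuous fun x => column d j (Ψ.toFun x) := fun j =>
    (column d j).continuous.comp Ψ.smooth.continuous
  have hcol' : ∀ j, Continuous fun x => column d j (partialDeriv Ψ.toFun j x) := fun j =>
    (column d j).continuous.comp (Ψ.continuous_partialDeriv j)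
  have hI : ∀ u v : Vec d → Vec d, Continuous u → Continuous v →
      (∀ x ∉ tsupport Ψ.toFun, u x = 0) → Integrable (fun x => ⟪u x, v x⟫) := by
    intro u v hu hv h0
    refine (hu.inner hv).integrable_of_hasCompactSupport
      (HasCompactSupport.intro Ψ.compact fun x hx => ?_)
    rw [h0 x hx, inner_zero_left]
  have h0 : ∀ j, ∀ x ∉ tsupport Ψ.toFun, column d j (Ψ.toFun x) = 0 := fun j x hx => by
    rw [image_eq_zero_of_notMem_tsupport hx, map_zero]
  have h0' : ∀ j, ∀ x ∉ tsupport Ψ.toFun, column d j (partialDeriv Ψ.toFun j x) = 0 :=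
    fun j x hx => by rw [Ψ.partialDeriv_eq_zero j x hx, map_zero]
  have hφ := φ.smooth.continuous
  have i1 := fun j => hI _ _ (hcol j) (φ.continuous_partialDeriv j) (h0 j)
  have i2 := fun j => hI _ _ (hcol' j) hφ (h0' j)
  have i3 := fun j => hI _ _ (hcol j) hφ (h0 j)
  have hL : ⟪Ψ.toL2, φ.gradL2⟫ = ∑ j, ∫ x, ⟪column d j (Ψ.toFun x), partialDeriv φ.toFun j x⟫ := by
    rw [L2.inner_def]
    refine Eq.trans ?_ (integral_finsetSum _ fun j _ => i1 j)
    refine Eq.trans ?_ (setIntegral_eq_integral_of_forall_compl_eq_zero (s := Ω) ?_)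
    · refine integral_congr_ae ?_
      filter_upwards [Ψ.memLp.coeFn_toLp, φ.memLp_grad.coeFn_toLp] with x h1 h2
      rw [TestField.toL2, TestField.gradL2, h1, h2, inner_grad]
    · intro x hx
      refine Finset.sum_eq_zero fun j _ => ?_
      rw [h0 j x fun h => hx (Ψ.supp h), inner_zero_left]
  have hR : ⟪Ψ.divergL2, φ.toL2⟫ =
      ∑ j, ∫ x, ⟪column d j (partialDeriv Ψ.toFun j x), φ.toFun x⟫ := by
    rw [L2.inner_def]
    refine Eq.trans ?_ (integral_finsetSum _ fun j _ => i2 j)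
    refine Eq.trans ?_ (setIntegral_eq_integral_of_forall_compl_eq_zero (s := Ω) ?_)
    · refine integral_congr_ae ?_
      filter_upwards [Ψ.memLp_diverg.coeFn_toLp, φ.memLp.coeFn_toLp] with x h1 h2
      rw [TestField.toL2, TestField.divergL2, h1, h2, inner_diverg]
    · intro x hx
      refine Finset.sum_eq_zero fun j _ => ?_
      rw [h0' j x fun h => hx (Ψ.supp h), inner_zero_left]
  rw [hL, hR, ← Finset.sum_neg_distrib]
  refine Finset.sum_congr rfl fun j _ => ?_
  exact integral_bilinear_fderiv_right_eq_neg_left_of_integrable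
    (B := (innerSL ℝ : Vec d →L[ℝ] Vec d →L[ℝ] ℝ).comp (column d j)) (i2 j) (i1 j) (i3 j)
    (fun x _ => (Ψ.smooth.differentiable (by simp)) x)
    (fun x _ => (φ.smooth.differentiable (by simp)) x)

/-- Since `L²(Ω)` is separable, countably many test fields suffice to detect weak gradients, so that
a condition that holds for each test field at almost all times gives a weak gradient at almost all
times. -/
theorem ae_hasWeakGrad {α : Type*} [MeasurableSpace α] {μ : Measure α} {v : α → L2Vec Ω}
    {G : α → L2Mat Ω}
    (h : ∀ Ψ : TestField Ω (Mat d), ∀ᵐ t ∂μ, ⟪v t, Ψ.divergL2⟫ + ⟪G t, Ψ.toL2⟫ = 0) :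
    ∀ᵐ t ∂μ, HasWeakGrad (v t) (G t) := by
  have : Fact ((2 : ℝ≥0∞) ≠ ∞) := ⟨by simp⟩
  have : SecondCountableTopology (L2Vec Ω) := Lp.SecondCountableTopology
  have : SecondCountableTopology (L2Mat Ω) := Lp.SecondCountableTopology
  set A : Set (L2Vec Ω × L2Mat Ω) :=
    range fun Ψ : TestField Ω (Mat d) => (Ψ.divergL2, Ψ.toL2) with hA
  obtain ⟨D, hDA, hDc, hD⟩ := TopologicalSpace.IsSeparable.exists_countable_dense_subset
    (TopologicalSpace.IsSeparable.of_separableSpace A)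
  have hae : ∀ᵐ t ∂μ, ∀ e ∈ D, ⟪v t, e.1⟫ + ⟪G t, e.2⟫ = 0 := by
    rw [ae_ball_iff hDc]
    intro e he
    obtain ⟨Ψ, rfl⟩ := hDA he
    exact h Ψ
  filter_upwards [hae] with t ht Ψ
  have hcl : IsClosed {e : L2Vec Ω × L2Mat Ω | ⟪v t, e.1⟫ + ⟪G t, e.2⟫ = 0} :=
    isClosed_eq (by fun_prop) continuous_const
  have := closure_minimal (fun e he => ht e he) hcl (hD (mem_range_self Ψ))
  exact eq_neg_of_add_eq_zero_left this

end TestFields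

namespace Model

variable {d : ℕ} (m : Model d)

/-! ### Two families of test functions -/

/-- The element `(Ψ, 0)` of `S` given by a smooth compactly supported `Ψ`. -/
def smoothTest (Ψ : TestField m.Ω (Mat d)) : m.S :=
  ⟨WithLp.toLp 2 (WithLp.toLp 2 (Ψ.toL2, 0), Ψ.divergL2), by
    refine ⟨map_zero _, ?_⟩
    have : m.jPlus (WithLp.toLp 2 (Ψ.toL2, 0)) = Ψ.toL2 := by simp [jPlus]
    change HasWeakDiv (m.jPlus (WithLp.toLp 2 (Ψ.toL2, 0))) Ψ.divergL2
    rw [this]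
    exact Ψ.hasWeakDiv⟩

/-- The element `(-ωτ, τ)` of `S`, whose total stress vanishes. -/
def balancedTest (τ : L2Mat m.Ω) (hτ : m.onElastic τ = 0) : m.S :=
  ⟨WithLp.toLp 2 (WithLp.toLp 2 (-m.mulOmega τ, τ), 0), by
    refine ⟨hτ, ?_⟩
    have : m.jPlus (WithLp.toLp 2 (-m.mulOmega τ, τ)) = 0 := by simp [jPlus]
    intro φ
    change ⟪m.jPlus (WithLp.toLp 2 (-m.mulOmega τ, τ)), _⟫ = -⟪(0 : L2Vec m.Ω), _⟫
    simp [this]⟩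

theorem jPlus_apply (q : PairL2 m.Ω) : m.jPlus q = q.fst + m.mulOmega q.snd := rfl

theorem jPlus_smoothTest (Ψ : TestField m.Ω (Mat d)) :
    m.jPlus (m.smoothTest Ψ).1.fst = Ψ.toL2 := by
  simp [jPlus_apply, smoothTest]

theorem jPlus_balancedTest (τ : L2Mat m.Ω) (hτ : m.onElastic τ = 0) :
    m.jPlus (m.balancedTest τ hτ).1.fst = 0 := by
  simp [jPlus_apply, balancedTest]

theorem boundaryTerm_mk (h : H1 m.Ω) (q : m.S) :
    m.boundaryTerm (Submodule.Quotient.mk h) q =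
      ⟪m.jPlus q.1.fst, H1.gradient h⟫ + ⟪q.1.snd, H1.value h⟫ := rfl

theorem boundaryTerm_smoothTest (b : TraceSpace m.Ω) (Ψ : TestField m.Ω (Mat d)) :
    m.boundaryTerm b (m.smoothTest Ψ) = 0 := by
  obtain ⟨h, rfl⟩ := Submodule.Quotient.mk_surjective _ b
  have h1 : ⟪H1.value h, Ψ.divergL2⟫ = -⟪H1.gradient h, Ψ.toL2⟫ := h.2 Ψ
  rw [boundaryTerm_mk, jPlus_smoothTest, real_inner_comm]
  change _ + ⟪Ψ.divergL2, H1.value h⟫ = 0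
  rw [real_inner_comm (H1.value h) Ψ.divergL2, h1, add_neg_cancel]

theorem boundaryTerm_balancedTest (b : TraceSpace m.Ω) (τ : L2Mat m.Ω)
    (hτ : m.onElastic τ = 0) : m.boundaryTerm b (m.balancedTest τ hτ) = 0 := by
  obtain ⟨h, rfl⟩ := Submodule.Quotient.mk_surjective _ b
  rw [boundaryTerm_mk, jPlus_balancedTest]
  simp [balancedTest]

/-! ### The weak equation tested without boundary contribution -/

/-- The linear form `x ↦ A(j_ω x, q)`. -/
def stressForm (q : PairL2 m.Ω) : PairL2 m.Ω →L[ℝ] ℝ :=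
  (innerSL ℝ q.fst).comp ((onL2 m.Ω m.tensorA).comp (WithLp.fstL 2 ℝ (L2Mat m.Ω) (L2Mat m.Ω))) +
    (innerSL ℝ q.snd).comp ((onL2 m.Ω m.tensorV).comp
      (m.mulOmega.comp (WithLp.sndL 2 ℝ (L2Mat m.Ω) (L2Mat m.Ω))))

/-- The linear form `x ↦ A(π₂ x, q)`. -/
def relaxForm (q : PairL2 m.Ω) : PairL2 m.Ω →L[ℝ] ℝ :=
  (innerSL ℝ q.snd).comp ((onL2 m.Ω m.tensorV).comp (WithLp.sndL 2 ℝ (L2Mat m.Ω) (L2Mat m.Ω)))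

theorem stressForm_apply (q x : PairL2 m.Ω) : m.stressForm q x =
    ⟪q.fst, onL2 m.Ω m.tensorA x.fst⟫ + ⟪q.snd, onL2 m.Ω m.tensorV (m.mulOmega x.snd)⟫ := rfl

theorem relaxForm_apply (q x : PairL2 m.Ω) :
    m.relaxForm q x = ⟪q.snd, onL2 m.Ω m.tensorV x.snd⟫ := rfl

theorem formA_jOmega_add_pi2 (x y q : PairL2 m.Ω) :
    m.formA (m.jOmega x + m.pi2 y) q = m.stressForm q x + m.relaxForm q y := by
  change ⟪onL2 m.Ω m.tensorA (x.fst + 0), q.fst⟫ +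
    ⟪onL2 m.Ω m.tensorV (m.mulOmega x.snd + y.snd), q.snd⟫ = _
  rw [add_zero, map_add, inner_add_left, stressForm_apply, relaxForm_apply,
    real_inner_comm q.fst, real_inner_comm q.snd, real_inner_comm q.snd, add_assoc]

/-- `symPair` as a continuous linear map. -/
def symPairL : m.SSym →L[ℝ] PairL2 m.Ω :=
  (WithLp.fstL 2 ℝ (PairL2 m.Ω) (L2Vec m.Ω)).comp m.SSym.subtypeL

/-- `symDiv` as a continuous linear map. -/
def symDivL : m.SSym →L[ℝ] L2Vec m.Ω :=
  (WithLp.sndL 2 ℝ (PairL2 m.Ω) (L2Vec m.Ω)).comp m.SSym.subtypeL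

variable {m} {F : ℝ → L2Vec m.Ω} {gdd : ℝ → TraceSpace m.Ω} {u₀ u₁ : H1 m.Ω} {σ₀ : L2Mat m.Ω}
  {p pd : ℝ → m.SSym} {r rd : ℝ → SkewL2 m.Ω} {u ud udd : ℝ → L2Vec m.Ω} {x g : ℝ → PairL2 m.Ω}

theorem IsSolution.hasTimeDeriv_symPair (hsol : m.IsSolution F gdd u₀ u₁ σ₀ p pd r)
    (hxp : ∀ᵐ t ∂(volume.restrict (Ioo 0 m.T)), x t = m.symPair (pd t)) :
    HasTimeDeriv m.T (fun t => m.symPair (p t)) x :=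
  (hsol.deriv.clm_comp m.symPairL).congr_deriv (hxp.mono fun _ h => h.symm)

/-- The momentum `A(j_ω ṗ + π₂ p, j_ω q) + (r, j_ω⁺ q)` belongs to `H¹(0, T)`, if `ṗ` is replaced
by its continuous representative `x`. -/
theorem IsSolution.hasTimeDeriv_momentum (hsol : m.IsSolution F gdd u₀ u₁ σ₀ p pd r)
    (hx : HasTimeDeriv m.T x g)
    (hxp : ∀ᵐ t ∂(volume.restrict (Ioo 0 m.T)), x t = m.symPair (pd t))
    (hr : HasTimeDeriv m.T r rd) (q : PairL2 m.Ω) :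
    HasTimeDeriv m.T
      (fun t => m.stressForm (m.jOmega q) (x t) + m.relaxForm (m.jOmega q) (m.symPair (p t))
        + ⟪m.jPlus q, (r t : L2Mat m.Ω)⟫)
      fun t => m.stressForm (m.jOmega q) (g t) + m.relaxForm (m.jOmega q) (x t)
        + ⟪m.jPlus q, (rd t : L2Mat m.Ω)⟫ :=
  ((hx.clm_comp (m.stressForm (m.jOmega q))).add
    ((hsol.hasTimeDeriv_symPair hxp).clm_comp (m.relaxForm (m.jOmega q)))).add
    (hr.clm_comp ((innerSL ℝ (m.jPlus q)).comp (SkewL2 m.Ω).subtypeL))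

/-- The weak equation for a test function without boundary contribution. The equation of motion
turns the terms with `F` and `div p` into the acceleration. -/
theorem IsSolution.ae_equation (hsol : m.IsSolution F gdd u₀ u₁ σ₀ p pd r)
    (hF : MemL2Time m.T F) (hu : m.IsDisplacement F u₀ u₁ p u ud udd)
    (hx : HasTimeDeriv m.T x g)
    (hxp : ∀ᵐ t ∂(volume.restrict (Ioo 0 m.T)), x t = m.symPair (pd t))
    (hr : HasTimeDeriv m.T r rd) (q : m.S) (hq : ∀ b, m.boundaryTerm b q = 0) :
    ∀ᵐ t ∂(volume.restrict (Ioo 0 m.T)),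
      m.stressForm (m.jOmega q.1.fst) (g t) + m.relaxForm (m.jOmega q.1.fst) (x t)
        + ⟪m.jPlus q.1.fst, (rd t : L2Mat m.Ω)⟫ + ⟪udd t, q.1.snd⟫ = 0 := by
  have hint : ∀ {v : ℝ → L2Vec m.Ω}, MemL2Time m.T v →
      IntegrableOn (fun t => ⟪v t, q.1.snd⟫) (Ioo 0 m.T) := fun {v} hv => by
    refine (hv.clm_comp (innerSL ℝ q.1.snd)).integrableOn.congr (ae_of_all _ fun t => ?_)
    exact real_inner_comm (v t) q.1.snd
  refine (hsol.hasTimeDeriv_momentum hx hxp hr q.1.fst).ae_eq_of_distrib m.T_pos.le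
    (hint hu.deriv2.1) fun ψ hψ hc hs => ?_
  have heq := hsol.equation q ψ hψ hc hs
  obtain ⟨M, hM⟩ := hψ.continuous.bounded_above_of_compact_support hc
  have hdiv : MemL2Time m.T fun t => m.divRho (m.symDiv (p t)) :=
    hsol.memL2.clm_comp (m.divRho.comp m.symDivL)
  have i1 : IntegrableOn (fun t => ψ t * m.innerRho (m.symDiv (p t)) q.1.snd) (Ioo 0 m.T) :=
    (hint hdiv).bdd_mul hψ.continuous.aestronglyMeasurable (ae_of_all _ hM)
  have i2 : IntegrableOn (fun t => ψ t * m.innerRho (F t) q.1.snd) (Ioo 0 m.T) :=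
    (hint (hF.clm_comp m.divRho)).bdd_mul hψ.continuous.aestronglyMeasurable (ae_of_all _ hM)
  have e1 : ∫ t in Ioo 0 m.T, _root_.deriv ψ t *
      (m.stressForm (m.jOmega q.1.fst) (x t) + m.relaxForm (m.jOmega q.1.fst) (m.symPair (p t))
        + ⟪m.jPlus q.1.fst, (r t : L2Mat m.Ω)⟫) =
      ∫ t in Ioo 0 m.T, _root_.deriv ψ t *
        (m.formA (m.jOmega (m.symPair (pd t)) + m.pi2 (m.symPair (p t))) (m.jOmega q.1.fst)
          + ⟪(r t : L2Mat m.Ω), m.jPlus q.1.fst⟫) := by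
    refine integral_congr_ae ?_
    filter_upwards [hxp] with t ht
    rw [formA_jOmega_add_pi2, ht, real_inner_comm]
  have e2 : ∫ t in Ioo 0 m.T, ψ t * ⟪udd t, q.1.snd⟫ =
      (∫ t in Ioo 0 m.T, ψ t * m.innerRho (m.symDiv (p t)) q.1.snd) +
        ∫ t in Ioo 0 m.T, ψ t * m.innerRho (F t) q.1.snd := by
    rw [← integral_add i1 i2]
    refine integral_congr_ae ?_
    filter_upwards [hu.motion] with t ht
    rw [ht, map_add, inner_add_left, innerRho, innerRho]
    ring
  have e3 : ∫ t in Ioo 0 m.T, ψ t * (-m.innerRho (F t) q.1.snd + m.boundaryTerm (gdd t) q) =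
      -∫ t in Ioo 0 m.T, ψ t * m.innerRho (F t) q.1.snd := by
    rw [← integral_neg]
    refine integral_congr_ae (ae_of_all _ fun t => ?_)
    simp only [hq]
    ring
  rw [e3] at heq
  rw [e1, e2]
  linarith

/-- Testing with smooth fields of compact support identifies the gradient of the acceleration. -/
theorem IsSolution.ae_hasWeakGrad_acceleration (hsol : m.IsSolution F gdd u₀ u₁ σ₀ p pd r)
    (hF : MemL2Time m.T F) (hu : m.IsDisplacement F u₀ u₁ p u ud udd)
    (hx : HasTimeDeriv m.T x g)
    (hxp : ∀ᵐ t ∂(volume.restrict (Ioo 0 m.T)), x t = m.symPair (pd t))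
    (hr : HasTimeDeriv m.T r rd) :
    ∀ᵐ t ∂(volume.restrict (Ioo 0 m.T)),
      HasWeakGrad (udd t) (onL2 m.Ω m.tensorA (g t).fst + (rd t : L2Mat m.Ω)) := by
  refine ae_hasWeakGrad fun Ψ => ?_
  filter_upwards [hsol.ae_equation hF hu hx hxp hr (m.smoothTest Ψ)
    fun b => m.boundaryTerm_smoothTest b Ψ] with t ht
  rw [jPlus_smoothTest, stressForm_apply, relaxForm_apply] at ht
  have e1 : (m.jOmega (m.smoothTest Ψ).1.fst).fst = Ψ.toL2 := rfl
  have e2 : (m.jOmega (m.smoothTest Ψ).1.fst).snd = 0 := map_zero _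
  have e3 : (m.smoothTest Ψ).1.snd = Ψ.divergL2 := rfl
  rw [e1, e2, e3, inner_zero_left, inner_zero_left] at ht
  rw [inner_add_left, real_inner_comm Ψ.toL2, real_inner_comm Ψ.toL2]
  linarith

/-- Testing with `(-ωτ, τ)`, for which the total stress vanishes, gives the constitutive law, here
integrated over `(0, t)`. -/
theorem IsSolution.constitutive (hsol : m.IsSolution F gdd u₀ u₁ σ₀ p pd r)
    (hF : MemL2Time m.T F) (hu : m.IsDisplacement F u₀ u₁ p u ud udd)
    (hx : HasTimeDeriv m.T x g)
    (hxp : ∀ᵐ t ∂(volume.restrict (Ioo 0 m.T)), x t = m.symPair (pd t))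
    (hr : HasTimeDeriv m.T r rd) {τ : L2Mat m.Ω} (hτ : m.onElastic τ = 0) {t : ℝ}
    (ht : t ∈ Icc 0 m.T) :
    ⟪m.mulOmega τ, onL2 m.Ω m.tensorV (m.mulOmega (x t - x 0).snd +
      (m.symPair (p t) - m.symPair (p 0)).snd) - onL2 m.Ω m.tensorA (x t - x 0).fst⟫ = 0 := by
  have h1 := hsol.ae_equation hF hu hx hxp hr (m.balancedTest τ hτ)
    fun b => m.boundaryTerm_balancedTest b τ hτ
  have e0 : (m.balancedTest τ hτ).1.snd = 0 := rfl
  -- The momentum tested with `(-ωτ, τ)` is conserved.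
  have h2 := ((hsol.hasTimeDeriv_momentum hx hxp hr (m.balancedTest τ hτ).1.fst).congr_deriv
    (g' := fun _ => 0) (h1.mono fun s hs => by rwa [e0, inner_zero_right, add_zero] at hs)).2 t ht
  rw [intervalIntegral.integral_zero] at h2
  have e1 : (m.jOmega (m.balancedTest τ hτ).1.fst).fst = -m.mulOmega τ := rfl
  have e2 : (m.jOmega (m.balancedTest τ hτ).1.fst).snd = m.mulOmega τ := rfl
  simp only [jPlus_balancedTest, inner_zero_left, stressForm_apply, relaxForm_apply, e1, e2,
    inner_neg_left] at h2
  simp only [WithLp.sub_fst, WithLp.sub_snd, map_add, map_sub, inner_add_right, inner_sub_right]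
  linarith

/-! ### Symmetry of the stress rates -/

theorem skew_mulOmega (m : Model d) (f : L2Mat m.Ω) :
    onL2 m.Ω (skewPart d) (m.mulOmega f) = m.mulOmega (onL2 m.Ω (skewPart d) f) :=
  m.onL2_mul _ _ f

theorem skew_divOmega (m : Model d) (f : L2Mat m.Ω) :
    onL2 m.Ω (skewPart d) (m.divOmega f) = m.divOmega (onL2 m.Ω (skewPart d) f) :=
  m.onL2_mul _ _ f

theorem onElastic_onL2 (m : Model d) (C : Mat d →L[ℝ] Mat d) (f : L2Mat m.Ω) :
    m.onElastic (onL2 m.Ω C f) = onL2 m.Ω C (m.onElastic f) :=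
  (m.onL2_mul _ _ f).symm

theorem skew_onL2_C (m : Model d) (f : L2Mat m.Ω) :
    onL2 m.Ω (skewPart d) (onL2 m.Ω m.C f) = onL2 m.Ω m.C (onL2 m.Ω (skewPart d) f) :=
  onL2_comm (m.C_symm.skewPart_comp m.C_preserves) f

theorem skew_onL2_D (m : Model d) (f : L2Mat m.Ω) :
    onL2 m.Ω (skewPart d) (onL2 m.Ω m.D f) = onL2 m.Ω m.D (onL2 m.Ω (skewPart d) f) :=
  onL2_comm (m.D_symm.skewPart_comp m.D_preserves) f

theorem skew_onL2_tensorA (m : Model d) (f : L2Mat m.Ω) :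
    onL2 m.Ω (skewPart d) (onL2 m.Ω m.tensorA f) =
      onL2 m.Ω m.tensorA (onL2 m.Ω (skewPart d) f) :=
  onL2_comm (m.C_posDef.commute_inverse (m.C_symm.skewPart_comp m.C_preserves)) f

theorem skew_onL2_tensorV (m : Model d) (f : L2Mat m.Ω) :
    onL2 m.Ω (skewPart d) (onL2 m.Ω m.tensorV f) =
      onL2 m.Ω m.tensorV (onL2 m.Ω (skewPart d) f) := by
  refine onL2_comm (m.diff_posDef.commute_inverse ?_) f
  rw [ContinuousLinearMap.comp_sub, ContinuousLinearMap.sub_comp,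
    m.D_symm.skewPart_comp m.D_preserves, m.C_symm.skewPart_comp m.C_preserves]

theorem onL2_C_tensorA (m : Model d) (f : L2Mat m.Ω) :
    onL2 m.Ω m.C (onL2 m.Ω m.tensorA f) = f :=
  m.C_posDef.onL2_onL2_inverse f

theorem onL2_sub_tensorV (m : Model d) (f : L2Mat m.Ω) :
    onL2 m.Ω (m.D - m.C) (onL2 m.Ω m.tensorV f) = f :=
  m.diff_posDef.onL2_onL2_inverse f

theorem eq_of_tensorV_sub_eq_tensorA (m : Model d) {a c : L2Mat m.Ω}
    (h : onL2 m.Ω m.tensorV (c - a) = onL2 m.Ω m.tensorA a) :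
    a = onL2 m.Ω m.C (onL2 m.Ω m.D.inverse c) := by
  have h1 : c - a = onL2 m.Ω (m.D - m.C) (onL2 m.Ω m.tensorA a) := by
    rw [← h, onL2_sub_tensorV]
  have h2 : c = onL2 m.Ω m.D (onL2 m.Ω m.tensorA a) := by
    rw [onL2_sub, onL2_C_tensorA] at h1
    exact sub_left_inj.mp h1
  rw [h2, m.D_posDef.onL2_inverse_onL2, onL2_C_tensorA]

theorem inner_mulOmega (m : Model d) (f g : L2Mat m.Ω) : ⟪m.mulOmega f, g⟫ = ⟪f, m.mulOmega g⟫ :=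
  m.inner_mul _ f g

theorem inner_divOmega (m : Model d) (f g : L2Mat m.Ω) : ⟪m.divOmega f, g⟫ = ⟪f, m.divOmega g⟫ :=
  m.inner_mul _ f g

/-- The subspace of all pairs `(η, τ)` with `τ = 0` on `Ω_E` and `η + ωτ` symmetric, which
contains the pairs in `S_sym` and makes no reference to the divergence. -/
def symmetricPairs (m : Model d) : Submodule ℝ (PairL2 m.Ω) :=
  LinearMap.ker (m.onElastic.comp (WithLp.sndL 2 ℝ (L2Mat m.Ω) (L2Mat m.Ω))).toLinearMap ⊓
    LinearMap.ker ((onL2 m.Ω (skewPart d)).comp m.jPlus).toLinearMap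

theorem mem_symmetricPairs {q : PairL2 m.Ω} : q ∈ m.symmetricPairs ↔
    m.onElastic q.snd = 0 ∧ onL2 m.Ω (skewPart d) (m.jPlus q) = 0 := Iff.rfl

theorem symPair_mem_symmetricPairs (s : m.SSym) : m.symPair s ∈ m.symmetricPairs :=
  ⟨s.2.1.1, skew_onL2_eq_zero s.2.2⟩

theorem skew_fst_of_mem {q : PairL2 m.Ω} (hq : q ∈ m.symmetricPairs) :
    onL2 m.Ω (skewPart d) q.fst = -m.mulOmega (onL2 m.Ω (skewPart d) q.snd) := by
  have h := hq.2
  change onL2 m.Ω (skewPart d) (m.jPlus q) = 0 at h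
  rw [jPlus_apply, map_add, skew_mulOmega] at h
  exact eq_neg_of_add_eq_zero_left h

theorem skew_snd_of_mem {q : PairL2 m.Ω} (hq : q ∈ m.symmetricPairs) :
    onL2 m.Ω (skewPart d) q.snd = -m.divOmega (onL2 m.Ω (skewPart d) q.fst) := by
  rw [skew_fst_of_mem hq, map_neg, neg_neg, m.divOmega_mulOmega]
  rw [onElastic_onL2, (mem_symmetricPairs.mp hq).1, map_zero]

/-- The continuous representative of `ṗ` inherits from `ṗ` the constraints of `S_sym`
that do not involve the divergence. -/
theorem mem_symmetricPairs_of_ae (hx : HasTimeDeriv m.T x g)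
    (hxp : ∀ᵐ t ∂(volume.restrict (Ioo 0 m.T)), x t = m.symPair (pd t)) {t : ℝ}
    (ht : t ∈ Icc 0 m.T) : x t ∈ m.symmetricPairs := by
  have key : ∀ L : PairL2 m.Ω →L[ℝ] L2Mat m.Ω, (∀ q ∈ m.symmetricPairs, L q = 0) → L (x t) = 0 :=
    fun L hL => eqOn_Icc_of_ae_eq (g := fun _ => 0) m.T_pos
      ((hx.clm_comp L).continuousOn m.T_pos.le) continuousOn_const
      (hxp.mono fun s hs => by rw [hs]; exact hL _ (symPair_mem_symmetricPairs _)) ht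
  exact ⟨key (m.onElastic.comp (WithLp.sndL 2 ℝ (L2Mat m.Ω) (L2Mat m.Ω))) fun q hq => hq.1,
    key ((onL2 m.Ω (skewPart d)).comp m.jPlus) fun q hq => hq.2⟩

/-- Pointwise algebra behind the evolution equation: if increments `y` of `ṗ` and `z` of `p` satisfy
`(D - C)⁻¹(ω y₂ + z₂) = C⁻¹ y₁` outside `Ω_E`, then the skew parts satisfy `a = C D⁻¹ c` with
`a = skew y₁`, `c = skew z₂`, because `ω skew y₂ = -a`. -/
theorem skew_fst_eq_of_constitutive {y z : PairL2 m.Ω} (hy : y ∈ m.symmetricPairs)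
    (hz : z ∈ m.symmetricPairs)
    (h : ∀ τ : L2Mat m.Ω, m.onElastic τ = 0 → ⟪m.mulOmega τ,
      onL2 m.Ω m.tensorV (m.mulOmega y.snd + z.snd) - onL2 m.Ω m.tensorA y.fst⟫ = 0) :
    onL2 m.Ω (skewPart d) y.fst =
      onL2 m.Ω m.C (onL2 m.Ω m.D.inverse (onL2 m.Ω (skewPart d) z.snd)) := by
  set a := onL2 m.Ω (skewPart d) y.fst with ha
  set c := onL2 m.Ω (skewPart d) z.snd with hc
  set e := onL2 m.Ω m.tensorV (m.mulOmega y.snd + z.snd) - onL2 m.Ω m.tensorA y.fst with he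
  have hωb : m.mulOmega (onL2 m.Ω (skewPart d) y.snd) = -a := by
    rw [ha, skew_fst_of_mem hy, neg_neg]
  -- The law holds outside `Ω_E`, where every field is of the form `ωτ`.
  have hNe : m.divOmega (m.mulOmega e) = 0 := by
    rw [← inner_self_eq_zero (𝕜 := ℝ)]
    have := h (m.divOmega (m.divOmega (m.mulOmega e))) (m.onElastic_divOmega _)
    rwa [inner_mulOmega, inner_divOmega] at this
  have hske : onL2 m.Ω (skewPart d) e = onL2 m.Ω m.tensorV (c - a) - onL2 m.Ω m.tensorA a := by
    rw [he, map_sub, skew_onL2_tensorV, skew_onL2_tensorA, map_add, skew_mulOmega, hωb,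
      neg_add_eq_sub]
  have hEa : m.onElastic a = 0 := by
    rw [← neg_eq_zero, ← map_neg, ← hωb, onElastic_mulOmega]
  have hEc : m.onElastic c = 0 := by
    rw [hc, onElastic_onL2, (mem_symmetricPairs.mp hz).1, map_zero]
  have hzero : onL2 m.Ω (skewPart d) e = 0 := by
    rw [← m.onElastic_add_divOmega_mulOmega (onL2 m.Ω (skewPart d) e), ← skew_mulOmega,
      ← skew_divOmega, hNe, map_zero, add_zero, hske, map_sub, onElastic_onL2, onElastic_onL2,
      map_sub, hEa, hEc]
    simp
  exact m.eq_of_tensorV_sub_eq_tensorA (sub_eq_zero.mp (hske.symm.trans hzero))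

theorem skew_C_strain (m : Model d) (v : H1 m.Ω) :
    onL2 m.Ω (skewPart d) (onL2 m.Ω m.C (H1.strain v)) = 0 := by
  rw [skew_onL2_C, H1.skew_strain, map_zero]

theorem skew_D_strain (m : Model d) (v : H1 m.Ω) :
    onL2 m.Ω (skewPart d) (onL2 m.Ω m.D (H1.strain v)) = 0 := by
  rw [skew_onL2_D, H1.skew_strain, map_zero]

/-- Since `γ₀` is symmetric, admissibility of the initial value forces `ζ₀` and hence `ζ₁` to be
symmetric. -/
theorem skew_initPairDot_snd (h : m.initPair u₀ σ₀ ∈ m.symmetricPairs) :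
    onL2 m.Ω (skewPart d) (m.initPairDot u₀ u₁ σ₀).snd = 0 := by
  have hγ₀ : onL2 m.Ω (skewPart d) (m.initPair u₀ σ₀).fst = 0 := m.skew_C_strain u₀
  have hζ₀ : onL2 m.Ω (skewPart d) (m.initPair u₀ σ₀).snd = 0 := by
    rw [skew_snd_of_mem h, hγ₀, map_zero, neg_zero]
  change onL2 m.Ω (skewPart d) (m.divOmega (onL2 m.Ω m.D (H1.strain u₁)
    - onL2 m.Ω m.C (H1.strain u₁) - (m.initPair u₀ σ₀).snd)) = 0
  generalize (m.initPair u₀ σ₀).snd = ζ₀ at hζ₀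
  rw [skew_divOmega, map_sub (onL2 m.Ω (skewPart d)), map_sub (onL2 m.Ω (skewPart d)),
    m.skew_D_strain, m.skew_C_strain, hζ₀, sub_zero, sub_zero, map_zero]

/-- For a projection `P` that commutes with `W`, testing with `(-W b, b)`, `b = P y₂`, gives
`‖W b‖² + ‖b‖² = 0`. -/
theorem apply_eq_zero_of_inner_eq {H : Type*} [NormedAddCommGroup H] [InnerProductSpace ℝ H]
    {P W : H →L[ℝ] H} (hsymm : ∀ v w, ⟪P v, w⟫ = ⟪v, P w⟫) (hproj : ∀ v, P (P v) = P v)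
    (hcomm : ∀ v, P (W v) = W (P v)) {y₁ y₂ z₁ z₂ : H} (hy : P y₁ = -W (P y₂)) (hz₁ : P z₁ = 0)
    (hz₂ : P z₂ = 0) (h : -⟪y₁, W (P y₂)⟫ + ⟪y₂, P y₂⟫ = -⟪z₁, W (P y₂)⟫ + ⟪z₂, P y₂⟫) :
    P y₂ = 0 := by
  have hs : ∀ v w, ⟪v, P w⟫ = ⟪P v, P w⟫ := fun v w => by rw [hsymm, hproj]
  rw [← hcomm, hs y₁, hs y₂, hs z₁, hs z₂, hy, hz₁, hz₂, hcomm, inner_neg_left, neg_neg,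
    inner_zero_left, inner_zero_left, neg_zero, add_zero] at h
  have n1 := real_inner_self_nonneg (x := W (P y₂))
  have n2 := real_inner_self_nonneg (x := P y₂)
  rw [← inner_self_eq_zero (𝕜 := ℝ)]
  linarith

/-- A pair with symmetric total stress that acts on the pairs `(-ωτ, τ)` like a pair of symmetric
fields has a symmetric second component. -/
theorem skew_snd_eq_zero_of_inner_eq {y z : PairL2 m.Ω} (hy : y ∈ m.symmetricPairs)
    (hz₁ : onL2 m.Ω (skewPart d) z.fst = 0) (hz₂ : onL2 m.Ω (skewPart d) z.snd = 0)
    (h : ∀ τ : L2Mat m.Ω, m.onElastic τ = 0 →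
      -⟪y.fst, m.mulOmega τ⟫ + ⟪y.snd, τ⟫ = -⟪z.fst, m.mulOmega τ⟫ + ⟪z.snd, τ⟫) :
    onL2 m.Ω (skewPart d) y.snd = 0 :=
  apply_eq_zero_of_inner_eq isSymmTensor_skewPart.inner_onL2
    (fun v => by rw [← onL2_comp, skewPart_comp_skewPart]) m.skew_mulOmega (skew_fst_of_mem hy)
    hz₁ hz₂ (h _ (by rw [onElastic_onL2, (mem_symmetricPairs.mp hy).1, map_zero]))

theorem toDual_apply (m : Model d) (z : PairL2 m.Ω) (s : m.SSym) :
    m.toDual z s = ⟪z, m.symPair s⟫ := rfl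

/-- The initial condition for `ṗ` holds for its continuous representative, as an identity of
functionals on `S_sym`. -/
theorem IsSolution.inner_initPairDot (hsol : m.IsSolution F gdd u₀ u₁ σ₀ p pd r)
    (hx : HasTimeDeriv m.T x g)
    (hxp : ∀ᵐ t ∂(volume.restrict (Ioo 0 m.T)), x t = m.symPair (pd t)) (s : m.SSym) :
    ⟪x 0, m.symPair s⟫ = ⟪m.initPairDot u₀ u₁ σ₀, m.symPair s⟫ := by
  obtain ⟨f, φ, hf, hfφ, hf0⟩ := hsol.velocity
  rw [← m.toDual_apply (m.initPairDot u₀ u₁ σ₀) s, ← hf0]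
  have hfc : ContinuousOn (fun t => f t s) (Icc 0 m.T) :=
    (hfφ.continuousOn m.T_pos.le).clm_apply continuousOn_const
  have hxc : ContinuousOn (fun t => ⟪x t, m.symPair s⟫) (Icc 0 m.T) :=
    (hx.continuousOn m.T_pos.le).inner continuousOn_const
  refine eqOn_Icc_of_ae_eq m.T_pos hxc hfc ?_ ⟨le_rfl, m.T_pos.le⟩
  filter_upwards [hf, hxp] with t h1 h2
  rw [h1, h2, toDual_apply]

theorem inner_balancedTest (m : Model d) (z : PairL2 m.Ω) (τ : L2Mat m.Ω)
    (hτ : m.onElastic τ = 0) :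
    ⟪z, (m.balancedTest τ hτ).1.fst⟫ = -⟪z.fst, m.mulOmega τ⟫ + ⟪z.snd, τ⟫ := by
  rw [← inner_neg_right]
  exact WithLp.prod_inner_apply z (m.balancedTest τ hτ).1.fst

/-- The initial condition for `ṗ`, tested with `S_sym` only, still forces the skew part of
`ζ'(0)` to vanish. -/
theorem IsSolution.skew_snd_zero (hsol : m.IsSolution F gdd u₀ u₁ σ₀ p pd r)
    (hx : HasTimeDeriv m.T x g)
    (hxp : ∀ᵐ t ∂(volume.restrict (Ioo 0 m.T)), x t = m.symPair (pd t)) :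
    onL2 m.Ω (skewPart d) (x 0).snd = 0 := by
  have h0 : (0 : ℝ) ∈ Icc 0 m.T := ⟨le_rfl, m.T_pos.le⟩
  have hinit : m.initPair u₀ σ₀ ∈ m.symmetricPairs := by
    rw [← hsol.init]
    exact symPair_mem_symmetricPairs (p 0)
  refine skew_snd_eq_zero_of_inner_eq (z := m.initPairDot u₀ u₁ σ₀)
    (mem_symmetricPairs_of_ae hx hxp h0) (m.skew_C_strain u₁)
    (skew_initPairDot_snd hinit) fun τ hτ => ?_
  rw [← m.inner_balancedTest (x 0) τ hτ, ← m.inner_balancedTest (m.initPairDot u₀ u₁ σ₀) τ hτ]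
  exact hsol.inner_initPairDot hx hxp ⟨(m.balancedTest τ hτ).1, (m.balancedTest τ hτ).2, by
    rw [jPlus_balancedTest, map_zero]⟩

/-- The increments of `γ'` are symmetric: the skew part `c` of `ζ(t) - ζ(0)` solves a linear
evolution equation with initial value zero. -/
theorem IsSolution.skew_fst_sub_eq_zero (hsol : m.IsSolution F gdd u₀ u₁ σ₀ p pd r)
    (hF : MemL2Time m.T F) (hu : m.IsDisplacement F u₀ u₁ p u ud udd)
    (hx : HasTimeDeriv m.T x g)
    (hxp : ∀ᵐ t ∂(volume.restrict (Ioo 0 m.T)), x t = m.symPair (pd t))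
    (hr : HasTimeDeriv m.T r rd) {t : ℝ} (ht : t ∈ Icc 0 m.T) :
    onL2 m.Ω (skewPart d) (x t - x 0).fst = 0 := by
  have h0 : (0 : ℝ) ∈ Icc 0 m.T := ⟨le_rfl, m.T_pos.le⟩
  have hmem : ∀ t ∈ Icc 0 m.T, x t - x 0 ∈ m.symmetricPairs := fun t ht =>
    sub_mem (mem_symmetricPairs_of_ae hx hxp ht) (mem_symmetricPairs_of_ae hx hxp h0)
  let K : L2Mat m.Ω →L[ℝ] L2Mat m.Ω := (onL2 m.Ω m.C).comp (onL2 m.Ω m.D.inverse)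
  let skewSnd : PairL2 m.Ω →L[ℝ] L2Mat m.Ω :=
    (onL2 m.Ω (skewPart d)).comp (WithLp.sndL 2 ℝ (L2Mat m.Ω) (L2Mat m.Ω))
  let c : ℝ → L2Mat m.Ω := fun t => skewSnd (m.symPair (p t) - m.symPair (p 0))
  have hfst : ∀ t ∈ Icc 0 m.T, onL2 m.Ω (skewPart d) (x t - x 0).fst = K (c t) := fun t ht =>
    skew_fst_eq_of_constitutive (hmem t ht)
      (sub_mem (symPair_mem_symmetricPairs _) (symPair_mem_symmetricPairs _))
      fun τ hτ => hsol.constitutive hF hu hx hxp hr hτ ht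
  have hsnd : ∀ t ∈ Icc 0 m.T, skewSnd (x t) = (-(m.divOmega.comp K)) (c t) := fun t ht => by
    have h1 := skew_snd_of_mem (hmem t ht)
    rw [hfst t ht, WithLp.sub_snd, map_sub, hsol.skew_snd_zero hx hxp, sub_zero] at h1
    exact h1
  have hp := (hsol.hasTimeDeriv_symPair hxp).clm_comp skewSnd
  have hc0 : c t = 0 := by
    refine eq_zero_of_eq_integral_clm (-(m.divOmega.comp K)) m.T_pos ?_ ?_ t ht
    · have := (hp.continuousOn m.T_pos.le).sub (continuousOn_const (c := skewSnd (m.symPair (p 0))))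
      exact this.congr fun s _ => map_sub _ _ _
    · intro t ht
      have h1 : c t = ∫ s in (0 : ℝ)..t, skewSnd (x s) := by
        change skewSnd (m.symPair (p t) - m.symPair (p 0)) = _
        rw [map_sub, sub_eq_iff_eq_add', ← hp.2 t ht]
      rw [h1]
      refine intervalIntegral.integral_congr fun s hs => ?_
      rw [uIcc_of_le ht.1] at hs
      exact hsnd s ⟨hs.1, hs.2.trans ht.2⟩
  rw [hfst t ht, hc0, map_zero]

end Model

/-! ### The displacement -/

namespace H1

variable {d : ℕ} {Ω : Set (Vec d)}

/-- `H1.value` as a continuous linear map. -/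
def valueL (Ω : Set (Vec d)) : H1 Ω →L[ℝ] L2Vec Ω :=
  (WithLp.fstL 2 ℝ (L2Vec Ω) (L2Mat Ω)).comp (H1 Ω).subtypeL

/-- `H1.gradient` as a continuous linear map. -/
def gradientL (Ω : Set (Vec d)) : H1 Ω →L[ℝ] L2Mat Ω :=
  (WithLp.sndL 2 ℝ (L2Vec Ω) (L2Mat Ω)).comp (H1 Ω).subtypeL

theorem value_add_integral {T : ℝ} {w : ℝ → H1 Ω} {v : ℝ → L2Vec Ω} (hw : MemL2Time T w)
    (h : H1 Ω) (hv : ∀ᵐ t ∂(volume.restrict (Ioo 0 T)), value (w t) = v t) {t : ℝ}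
    (ht : t ∈ Icc 0 T) :
    value (h + ∫ s in (0 : ℝ)..t, w s) = value h + ∫ s in (0 : ℝ)..t, v s := by
  have h1 := (valueL Ω).intervalIntegral_comp_comm (hw.intervalIntegrable_of_mem ht)
  have h2 : ∫ s in (0 : ℝ)..t, valueL Ω (w s) = ∫ s in (0 : ℝ)..t, v s :=
    intervalIntegral_congr_time hv ht
  rw [← h2, h1]
  exact map_add (valueL Ω) _ _

theorem gradient_add_integral {T : ℝ} {w : ℝ → H1 Ω} {G : ℝ → L2Mat Ω} (hw : MemL2Time T w)
    (h : H1 Ω) (hG : ∀ᵐ t ∂(volume.restrict (Ioo 0 T)), gradient (w t) = G t) {t : ℝ}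
    (ht : t ∈ Icc 0 T) :
    gradient (h + ∫ s in (0 : ℝ)..t, w s) = gradient h + ∫ s in (0 : ℝ)..t, G s := by
  have h1 := (gradientL Ω).intervalIntegral_comp_comm (hw.intervalIntegrable_of_mem ht)
  have h2 : ∫ s in (0 : ℝ)..t, gradientL Ω (w s) = ∫ s in (0 : ℝ)..t, G s :=
    intervalIntegral_congr_time hG ht
  rw [← h2, h1]
  exact map_add (gradientL Ω) _ _

/-- Square integrable functions of time that are almost everywhere a field and its weak gradient
come from an element of `L²(0, T; H¹(Ω)^d)`; orthogonal projection onto the closed subspace `H¹`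
provides a measurable choice. -/
theorem exists_memL2Time {T : ℝ} {v : ℝ → L2Vec Ω} {G : ℝ → L2Mat Ω} (hv : MemL2Time T v)
    (hG : MemL2Time T G) (h : ∀ᵐ t ∂(volume.restrict (Ioo 0 T)), HasWeakGrad (v t) (G t)) :
    ∃ w : ℝ → H1 Ω, MemL2Time T w ∧
      ∀ᵐ t ∂(volume.restrict (Ioo 0 T)), value (w t) = v t ∧ gradient (w t) = G t := by
  let e := (WithLp.prodContinuousLinearEquiv 2 ℝ (L2Vec Ω) (L2Mat Ω)).symm
  let z : ℝ → WithLp 2 (L2Vec Ω × L2Mat Ω) := fun t => WithLp.toLp 2 (v t, G t)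
  have hz : MemL2Time T z := by
    have h1 := (hv.clm_comp (e.toContinuousLinearMap.comp
      (ContinuousLinearMap.inl ℝ (L2Vec Ω) (L2Mat Ω)))).add
      (hG.clm_comp (e.toContinuousLinearMap.comp
        (ContinuousLinearMap.inr ℝ (L2Vec Ω) (L2Mat Ω))))
    refine h1.congr (ae_of_all _ fun t => ?_)
    change e (v t, 0) + e (0, G t) = e (v t, G t)
    rw [← map_add, Prod.mk_add_mk, add_zero, zero_add]
  refine ⟨fun t => (H1 Ω).orthogonalProjectionOnto (z t), hz.clm_comp _, ?_⟩
  filter_upwards [h] with t ht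
  have hmem : z t ∈ H1 Ω := ht
  have hproj := (H1 Ω).orthogonalProjectionOnto_mem_subspace_eq_self ⟨z t, hmem⟩
  have hcoe : (H1 Ω).orthogonalProjectionOnto (z t) = ⟨z t, hmem⟩ := hproj
  rw [hcoe]
  exact ⟨rfl, rfl⟩

end H1

namespace Model

variable {d : ℕ} {m : Model d} {r rd : ℝ → SkewL2 m.Ω} {x g : ℝ → PairL2 m.Ω}

theorem hasTimeDeriv_tensorA_fst_add (hx : HasTimeDeriv m.T x g) (hr : HasTimeDeriv m.T r rd) :
    HasTimeDeriv m.T (fun t => onL2 m.Ω m.tensorA (x t).fst + (r t : L2Mat m.Ω))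
      fun t => onL2 m.Ω m.tensorA (g t).fst + (rd t : L2Mat m.Ω) :=
  (hx.clm_comp ((onL2 m.Ω m.tensorA).comp (WithLp.fstL 2 ℝ (L2Mat m.Ω) (L2Mat m.Ω)))).add
    (hr.clm_comp (SkewL2 m.Ω).subtypeL)

/-- If the increments of `γ'` are symmetric, the skew part of the integral of `C⁻¹γ'' + r'` is the
multiplier. -/
theorem skew_integral_eq (hx : HasTimeDeriv m.T x g) (hr : HasTimeDeriv m.T r rd) (hr0 : r 0 = 0)
    {t : ℝ} (ht : t ∈ Icc 0 m.T) (hskew : onL2 m.Ω (skewPart d) (x t - x 0).fst = 0) :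
    onL2 m.Ω (skewPart d)
      (∫ s in (0 : ℝ)..t, (onL2 m.Ω m.tensorA (g s).fst + (rd s : L2Mat m.Ω))) = r t := by
  have h := (hasTimeDeriv_tensorA_fst_add hx hr).2 t ht
  beta_reduce at h
  rw [hr0, ZeroMemClass.coe_zero, add_zero] at h
  rw [← sub_eq_iff_eq_add'.mpr h, add_sub_right_comm, ← map_sub, ← WithLp.sub_fst, map_add,
    skew_onL2_tensorA, hskew, map_zero, zero_add, skew_onL2_of_mem_SkewL2 (r t).2]

end Model

end Zener

end

open Zener in
theorem proposition4p1 {d : ℕ} (hd : d = 2 ∨ d = 3) (m : Model d)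
    (F : ℝ → L2Vec m.Ω) (hF : MemL2Time m.T F)
    (g gd gdd : ℝ → TraceSpace m.Ω) (hg : HasTimeDeriv m.T g gd) (hgd : HasTimeDeriv m.T gd gdd)
    (u₀ u₁ : H1 m.Ω) (σ₀ : L2Mat m.Ω)
    (p pd : ℝ → m.SSym) (r : ℝ → SkewL2 m.Ω) (hsol : m.IsSolution F gdd u₀ u₁ σ₀ p pd r)
    (u ud udd : ℝ → L2Vec m.Ω) (hu : m.IsDisplacement F u₀ u₁ p u ud udd)
    (hp : MemH1Time m.T fun t => m.symPair (pd t))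
    (hr : ∃ rd : ℝ → SkewL2 m.Ω, HasTimeDeriv m.T r rd) :
    (∃ w : ℝ → H1 m.Ω, MemL2Time m.T w ∧
      ∀ᵐ t ∂(MeasureTheory.volume.restrict (Set.Ioo 0 m.T)), H1.value (w t) = udd t) ∧
    ∀ t ∈ Set.Icc 0 m.T, ∃ h : H1 m.Ω, H1.value h = ud t ∧
      (r t : L2Mat m.Ω) = onL2 m.Ω (skewPart d) (H1.gradient h) - onL2 m.Ω (skewPart d) (H1.gradient u₁) := by
  obtain ⟨rd, hrd⟩ := hr
  obtain ⟨x, y, hxp, hx⟩ := hp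
  -- The gradient of the acceleration is the time derivative of `C⁻¹ γ' + r`.
  obtain ⟨w, hw, hwae⟩ := H1.exists_memL2Time hu.deriv2.1
    (Model.hasTimeDeriv_tensorA_fst_add hx hrd).1
    (hsol.ae_hasWeakGrad_acceleration hF hu hx hxp hrd)
  refine ⟨⟨w, hw, hwae.mono fun t h => h.1⟩, fun t ht => ?_⟩
  refine ⟨u₁ + ∫ s in (0 : ℝ)..t, w s, ?_, ?_⟩
  · rw [H1.value_add_integral hw u₁ (hwae.mono fun s h => h.1) ht, hu.deriv2.2 t ht, hu.initDot]
  · rw [H1.gradient_add_integral hw u₁ (hwae.mono fun s h => h.2) ht, map_add,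
      Model.skew_integral_eq hx hrd hsol.init_r ht
        (hsol.skew_fst_sub_eq_zero hF hu hx hxp hrd ht), add_sub_cancel_left]
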